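/- Let $n\ge 1$ and $0\le q\le n-1$ be integers. The Harary index of a finite connected graph $G$ is $H(G)=\sum_{\{u,v\}}\frac{1}{d(u,v)}$, the sum over all unordered pairs of distinct vertices, where $d$ is the graph distance. For $1\le k\le n-1$ (or $n=1$, $k=0$), let $T_{n,k}$ be the balanced starlike tree: a centre with $k$ pendent paths attached to it, containing $n_1\ge\dots\ge n_k\ge 1$ further vertices respectively, where $n_1+\dots+n_k=n-1$ and $|n_i-n_j|\le 1$ for all $i,j$ (for $k\le 2$ this is a path). If $q=n-3$, or if $q=n-1$ and $n\ge 2$, then there is no tree with $n$ vertices of which exactly $q$ have degree two. In all other cases $T_{n,n-1-q}$ is a tree with $n$ vertices, exactly $q$ of which have degree two, and it is, up to isomorphism, the unique tree of maximal Harary index in this class: every tree $T$ with $n$ vertices, exactly $q$ of which have degree two, satisfies $H(T)\le H(T_{n,n-1-q})$, with equality if and only if $T\cong T_{n,n-1-q}$. -/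

import Mathlib

/-- The reciprocal distance (Harary) matrix of a graph: `1 / d(u, v)` off the diagonal,
`0` on the diagonal. -/
noncomputable def SimpleGraph.reciprocalDistMatrix {V : Type*} (G : SimpleGraph V) :
    Matrix V V ℝ :=
  open Classical in Matrix.of fun u v => if u = v then 0 else 1 / (G.dist u v : ℝ)

/-- The Harary index: the half-sum of all entries of the reciprocal distance matrix, i.e. the sum of
`1 / d(u, v)` over the unordered pairs of distinct vertices. -/
noncomputable def SimpleGraph.hararyIndex {V : Type*} [Fintype V] (G : SimpleGraph V) : ℝ :=
  (1 / 2) * ∑ u : V, ∑ v : V, G.reciprocalDistMatrix u v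

/-- The number of vertices of degree two. -/
noncomputable def SimpleGraph.numDegreeTwo {V : Type*} [Fintype V] (G : SimpleGraph V) : ℕ :=
  open Classical in (Finset.univ.filter fun v : V => G.degree v = 2).card

/-- The graph `S(l₁, …, l_k)`: a centre `none` with `k` pendent paths attached to it, the `i`-th one
having the `l i` vertices `⟨i, 0⟩, ⟨i, 1⟩, …`, where `⟨i, 0⟩` is the one next to the centre. -/
def starlikeTree {k : ℕ} (l : Fin k → ℕ) : SimpleGraph (Option (Σ i : Fin k, Fin (l i))) :=
  SimpleGraph.fromRel fun x y =>
    match x, y with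
    | none, some b => b.2.val = 0
    | some a, some b => a.1 = b.1 ∧ a.2.val + 1 = b.2.val
    | _, none => False

/-- The almost equal lengths of `k` paths with `n - 1` vertices altogether, in weakly decreasing
order. -/
def balancedLength (n k : ℕ) (i : Fin k) : ℕ :=
  (n - 1) / k + if i.val < (n - 1) % k then 1 else 0

theorem balancedLength_le_add_one (n k : ℕ) (i j : Fin k) :
    balancedLength n k i ≤ balancedLength n k j + 1 := by
  unfold balancedLength
  split_ifs <;> omega

theorem sum_balancedLength (n k : ℕ) (hk : 1 ≤ k) :
    ∑ i : Fin k, balancedLength n k i = n - 1 := by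
  have h : (n - 1) % k < k := Nat.mod_lt _ hk
  have h2 : ∑ i : Fin k, (if i.val < (n - 1) % k then 1 else 0) = (n - 1) % k := by
    rw [Fin.sum_univ_eq_sum_range (fun i => if i < (n - 1) % k then 1 else 0) k,
      Finset.sum_ite, Finset.sum_const_zero, Finset.sum_const]
    have : (Finset.range k).filter (fun i => i < (n - 1) % k) = Finset.range ((n - 1) % k) := by
      ext x
      simp only [Finset.mem_filter, Finset.mem_range]
      omega
    rw [this]
    simp
  unfold balancedLength
  rw [Finset.sum_add_distrib, h2]
  simp [Nat.div_add_mod]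

/-- The balanced starlike tree on `n` vertices with `k` pendent paths. -/
abbrev balancedStarlikeTree (n k : ℕ) :
    SimpleGraph (Option (Σ i : Fin k, Fin (balancedLength n k i))) :=
  starlikeTree (balancedLength n k)

/-! Root `T` at a vertex `r` of degree other than two and match every other vertex with the edge to
its parent. In a tree, a path of length at least two corresponds to the pair of its end edges, while
a path of length one has a single end edge. So `2 * H(T)` is `n - 1` plus the sum of `1 / edgeSpan`
over ordered pairs of edges (`IsParentMap.two_mul_hararyIndex`).

Cut `T` into segments, the paths whose inner vertices have degree two. There are `k = n - 1 - q` of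
them, with lengths summing to `n - 1`. Two edges of one segment contribute what they contribute in
any path of that length; edges of different segments span at least as much as they would if the
segments shared an end. Hence `H(T) ≤ starlikeSum s` for the segment lengths `s`
(`hararyIndex_le_starlikeSum`), and the starlike tree with legs `s` has at least this index
(`starlikeSum_le_hararyIndex`).

Moving an edge from one leg to another that is shorter by at least two does not change the path
formed by the two legs, and brings the edge closer to every third leg. So for `k ≥ 3` only balanced
lengths are optimal (`starlikeSum_le_balancedLength`); `k ≤ 1` is trivial, and `k = 2` is the
excluded `q = n - 3`.

For equality, `r` is chosen of degree at least three when `k ≥ 2`. A segment not ending at `r` then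
lies at positive distance from some segment in another branch at `r`, a strict loss; so all segments
hang from `r`. Degree counting yields both the root and the nonexistence cases. -/

namespace SimpleGraph

/-! ### Rooted trees: parents, ancestors and distances. -/

variable {V : Type*} {T : SimpleGraph V} {r : V} {p : V → V}

/-- `p` sends every vertex of the connected graph `T` to its parent with respect to the root `r`. -/
structure IsParentMap (T : SimpleGraph V) (r : V) (p : V → V) : Prop where
  connected : T.Connected
  root : p r = r
  adj_iff : ∀ u v, T.Adj u v ↔ (u ≠ r ∧ p u = v) ∨ (v ≠ r ∧ p v = u)
  dist_parent : ∀ v, v ≠ r → T.dist r (p v) + 1 = T.dist r v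

theorem Connected.exists_adj_dist_add_one (hT : T.Connected) {v : V} (hv : v ≠ r) :
    ∃ u, T.Adj v u ∧ T.dist r u + 1 = T.dist r v := by
  obtain ⟨w, hw⟩ := hT.exists_walk_length_eq_dist v r
  cases w with
  | nil => exact absurd rfl hv
  | @cons _ u _ h w =>
    refine ⟨u, h, ?_⟩
    have h1 := dist_le w
    have h2 : T.dist v r ≤ T.dist v u + T.dist u r := hT.dist_triangle
    rw [dist_eq_one_iff_adj.mpr h] at h2
    rw [Walk.length_cons] at hw
    rw [dist_comm (u := r) (v := u), dist_comm (u := r) (v := v)]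
    omega

/-- Each of the two neighbours begins a geodesic from `v` to `r`, and a tree has only one path
between them. -/
theorem IsTree.eq_of_adj_dist_add_one (hT : T.IsTree) {v u u' : V}
    (h : T.Adj v u) (hu : T.dist r u + 1 = T.dist r v)
    (h' : T.Adj v u') (hu' : T.dist r u' + 1 = T.dist r v) : u = u' := by
  obtain ⟨w, hw⟩ := hT.connected.exists_walk_length_eq_dist u r
  obtain ⟨w', hw'⟩ := hT.connected.exists_walk_length_eq_dist u' r
  rw [dist_comm] at hw hw'
  have hp : (Walk.cons h w).IsPath := by
    apply Walk.isPath_of_length_eq_dist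
    rw [Walk.length_cons, dist_comm (u := v)]
    omega
  have hp' : (Walk.cons h' w').IsPath := by
    apply Walk.isPath_of_length_eq_dist
    rw [Walk.length_cons, dist_comm (u := v)]
    omega
  have := (hT.existsUnique_path v r).unique hp hp'
  simpa using congrArg Walk.snd this

theorem IsTree.exists_isParentMap (hT : T.IsTree) (r : V) : ∃ p, IsParentMap T r p := by
  classical
  have H : ∀ v, ∃ u, (v = r → u = r) ∧ (v ≠ r → T.Adj v u ∧ T.dist r u + 1 = T.dist r v) := by
    intro v
    by_cases hv : v = r
    · exact ⟨r, fun _ => rfl, fun h => absurd hv h⟩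
    · obtain ⟨u, hu⟩ := hT.connected.exists_adj_dist_add_one hv
      exact ⟨u, fun h => absurd h hv, fun _ => hu⟩
  choose p hp1 hp2 using H
  refine ⟨p, hT.connected, hp1 r rfl, fun u v => ⟨fun h => ?_, ?_⟩, fun v hv => (hp2 v hv).2⟩
  · rcases hT.dist_eq_dist_add_one_of_adj r h with h1 | h1
    · have hu : u ≠ r := by rintro rfl; simp at h1
      exact Or.inl ⟨hu, hT.eq_of_adj_dist_add_one (hp2 u hu).1 (hp2 u hu).2 h h1.symm⟩
    · have hv : v ≠ r := by rintro rfl; simp at h1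
      exact Or.inr ⟨hv, hT.eq_of_adj_dist_add_one (hp2 v hv).1 (hp2 v hv).2 h.symm h1.symm⟩
  · rintro (⟨hu, rfl⟩ | ⟨hv, rfl⟩)
    · exact (hp2 u hu).1
    · exact (hp2 v hv).1.symm

theorem IsParentMap.adj_parent (h : IsParentMap T r p) {v : V} (hv : v ≠ r) : T.Adj v (p v) :=
  (h.adj_iff _ _).2 (Or.inl ⟨hv, rfl⟩)

theorem IsParentMap.iterate_root (h : IsParentMap T r p) (j : ℕ) : p^[j] r = r :=
  Function.iterate_fixed h.root j

/-- Truncated subtraction is right because `p` fixes the root. -/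
theorem IsParentMap.dist_root_iterate (h : IsParentMap T r p) (j : ℕ) (v : V) :
    T.dist r (p^[j] v) = T.dist r v - j := by
  induction j with
  | zero => simp
  | succ j ih =>
    rw [Function.iterate_succ_apply']
    by_cases hr : p^[j] v = r
    · rw [hr, h.root]
      rw [hr] at ih
      simp only [dist_self] at ih ⊢
      omega
    · have := h.dist_parent _ hr
      omega

theorem IsParentMap.iterate_eq_root_iff (h : IsParentMap T r p) (j : ℕ) (v : V) :
    p^[j] v = r ↔ T.dist r v ≤ j := by
  have h1 := h.dist_root_iterate j v
  rw [eq_comm, ← h.connected.dist_eq_zero_iff, h1, Nat.sub_eq_zero_iff_le]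

theorem IsParentMap.dist_iterate_le (h : IsParentMap T r p) (j : ℕ) (v : V) :
    T.dist (p^[j] v) v ≤ j := by
  induction j with
  | zero => simp
  | succ j ih =>
    rw [Function.iterate_succ_apply']
    by_cases hr : p^[j] v = r
    · rw [hr, h.root]
      rw [hr] at ih
      omega
    · have h1 := dist_eq_one_iff_adj.mpr (h.adj_parent hr).symm
      have h2 : T.dist (p (p^[j] v)) v ≤ T.dist (p (p^[j] v)) (p^[j] v) + T.dist (p^[j] v) v :=
        h.connected.dist_triangle
      omega

theorem IsParentMap.dist_iterate (h : IsParentMap T r p) {j : ℕ} {v : V} (hj : j ≤ T.dist r v) :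
    T.dist (p^[j] v) v = j := by
  have h1 := h.dist_iterate_le j v
  have h2 : T.dist r v ≤ T.dist r (p^[j] v) + T.dist (p^[j] v) v := h.connected.dist_triangle
  have h3 := h.dist_root_iterate j v
  omega

/-- Makes the witness of an ancestor relation canonical: superfluous steps can only be spent at the
root. -/
theorem IsParentMap.iterate_dist (h : IsParentMap T r p) {j : ℕ} {u v : V} (hu : p^[j] v = u) :
    p^[T.dist u v] v = u := by
  by_cases hj : j ≤ T.dist r v
  · rw [← hu, h.dist_iterate hj]
  · have hr : u = r := hu ▸ (h.iterate_eq_root_iff j v).2 (by omega)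
    rw [hr]
    exact (h.iterate_eq_root_iff _ v).2 le_rfl

/-- `u` is `w` or an ancestor of `w`. -/
def IsAncestor (p : V → V) (u w : V) : Prop := ∃ j, p^[j] w = u

theorem IsAncestor.refl (p : V → V) (u : V) : IsAncestor p u u := ⟨0, rfl⟩

theorem IsAncestor.trans {a b c : V} (h : IsAncestor p a b) (h' : IsAncestor p b c) :
    IsAncestor p a c := by
  obtain ⟨i, rfl⟩ := h
  obtain ⟨j, rfl⟩ := h'
  exact ⟨i + j, Function.iterate_add_apply _ _ _ _⟩

theorem IsParentMap.isAncestor_root (h : IsParentMap T r p) (v : V) : IsAncestor p r v :=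
  ⟨_, (h.iterate_eq_root_iff _ v).2 le_rfl⟩

theorem IsParentMap.dist_of_isAncestor (h : IsParentMap T r p) {u w : V} (hu : IsAncestor p u w) :
    T.dist r w = T.dist r u + T.dist u w := by
  obtain ⟨j, hj⟩ := hu
  have h1 := h.iterate_dist hj
  have h2 := h.dist_root_iterate (T.dist u w) w
  rw [h1] at h2
  by_contra hne
  have hr : u = r := by
    rw [← h1, h.iterate_eq_root_iff]
    by_contra h3
    omega
  subst hr
  simp at hne

theorem IsParentMap.isAncestor_antisymm (h : IsParentMap T r p) {u w : V}
    (h1 : IsAncestor p u w) (h2 : IsAncestor p w u) : u = w := by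
  have h3 := h.dist_of_isAncestor h1
  have h4 := h.dist_of_isAncestor h2
  exact (h.connected.dist_eq_zero_iff).1 (by omega)

/-- The edge from `p w` to `w` is the only way into the part of the tree below `w`, so a walk coming
from outside has to cross it. -/
theorem IsParentMap.dist_parent_add_one_le_length (h : IsParentMap T r p) {w : V} (hw : w ≠ r)
    {x : V} (q : T.Walk x w) (hx : ¬ IsAncestor p w x) : T.dist x (p w) + 1 ≤ q.length := by
  induction q with
  | nil => exact absurd (IsAncestor.refl p _) hx
  | @cons a b c hab q ih =>
    rw [Walk.length_cons]
    by_cases hb : IsAncestor p c b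
    · have : a = p c := by
        rcases (h.adj_iff _ _).1 hab with ⟨ha, hab'⟩ | ⟨hb', hab'⟩
        · exfalso
          apply hx
          exact hb.trans ⟨1, hab'⟩
        · obtain ⟨j, hj⟩ := hb
          cases j with
          | zero => rw [← hab', ← hj]; rfl
          | succ j =>
            exfalso
            apply hx
            refine ⟨j, ?_⟩
            rw [← hab', ← hj]
            rfl
      rw [this]
      simp
    · have h1 := ih hw hb
      have h2 : T.dist a (p c) ≤ T.dist a b + T.dist b (p c) := h.connected.dist_triangle
      rw [dist_eq_one_iff_adj.mpr hab] at h2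
      omega

theorem IsParentMap.dist_of_not_isAncestor (h : IsParentMap T r p) {w x : V}
    (hx : ¬ IsAncestor p w x) : T.dist w x = T.dist (p w) x + 1 := by
  have hw : w ≠ r := by
    rintro rfl
    exact hx (h.isAncestor_root x)
  obtain ⟨q, hq⟩ := h.connected.exists_walk_length_eq_dist x w
  have h1 := h.dist_parent_add_one_le_length hw q hx
  have h2 : T.dist w x ≤ T.dist w (p w) + T.dist (p w) x := h.connected.dist_triangle
  rw [dist_eq_one_iff_adj.mpr (h.adj_parent hw)] at h2
  rw [dist_comm (u := x) (v := p w)] at h1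
  rw [dist_comm (u := x)] at hq
  omega

theorem IsParentMap.dist_of_forall_not_isAncestor (h : IsParentMap T r p) {w x : V} (m : ℕ)
    (hx : ∀ i < m, ¬ IsAncestor p (p^[i] w) x) : T.dist w x = m + T.dist (p^[m] w) x := by
  induction m with
  | zero => simp
  | succ m ih =>
    rw [ih fun i hi => hx i (by omega), h.dist_of_not_isAncestor (hx m (by omega)),
      Function.iterate_succ_apply']
    omega

end SimpleGraph

/-! ### Segments: climbing from a vertex of `B` to the next one. -/

namespace SimpleGraph

variable {V : Type*} {T : SimpleGraph V} {r : V} {p : V → V} {B : V → Prop}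

/-- The number of steps from `v` to its closest proper ancestor in `B`. -/
noncomputable def segLen (p : V → V) (B : V → Prop) (v : V) : ℕ :=
  sInf {s | 1 ≤ s ∧ B (p^[s] v)}

theorem segLen_le {v : V} {s : ℕ} (hs : 1 ≤ s) (hB : B (p^[s] v)) : segLen p B v ≤ s :=
  Nat.sInf_le ⟨hs, hB⟩

theorem not_of_lt_segLen {v : V} {s : ℕ} (hs : 1 ≤ s) (hlt : s < segLen p B v) : ¬ B (p^[s] v) :=
  fun hB => absurd (segLen_le hs hB) (by omega)

theorem IsParentMap.segLen_spec (h : IsParentMap T r p) (hr : B r) (v : V) :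
    1 ≤ segLen p B v ∧ B (p^[segLen p B v] v) := by
  have hne : {s | 1 ≤ s ∧ B (p^[s] v)}.Nonempty :=
    -- The extra step keeps the witness positive when `v = r`; it stays at the root.
    ⟨T.dist r v + 1, by omega, by rwa [(h.iterate_eq_root_iff _ v).2 (by omega)]⟩
  exact Nat.sInf_mem hne

theorem IsParentMap.segLen_le_dist (h : IsParentMap T r p) (hr : B r) {v : V} (hv : v ≠ r) :
    segLen p B v ≤ T.dist r v :=
  segLen_le (h.connected.pos_dist_of_ne hv.symm)
    (by rwa [(h.iterate_eq_root_iff _ v).2 le_rfl])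

theorem IsParentMap.lt_dist_of_lt_segLen (h : IsParentMap T r p) (hr : B r) {v : V} (hv : v ≠ r)
    {a : ℕ} (ha : a < segLen p B v) : a < T.dist r v :=
  ha.trans_le (h.segLen_le_dist hr hv)

theorem IsParentMap.iterate_ne_root (h : IsParentMap T r p) (hr : B r) {v : V} (hv : v ≠ r)
    {a : ℕ} (ha : a < segLen p B v) : p^[a] v ≠ r := by
  rw [Ne, h.iterate_eq_root_iff]
  have := h.lt_dist_of_lt_segLen hr hv ha
  omega

/-- Every vertex outside `B` has exactly one child. -/
def HasUniqueChild (r : V) (p : V → V) (B : V → Prop) : Prop :=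
  ∀ v, ¬ B v → ∃! u, u ≠ r ∧ p u = v

/-- Above `v'` and up to `p^[b] v'` no vertex is in `B`, so each has one child and both climbs can
be retraced in step down to `v'`. The climb from `v` cannot run out earlier, as `v` is in `B`. This
makes segments disjoint. -/
theorem IsParentMap.exists_iterate_eq_of_iterate_eq (h : IsParentMap T r p) (hr : B r)
    (hB : HasUniqueChild r p B) {v v' : V} (hv : B v) {m b : ℕ}
    (hb : b < segLen p B v') (hm : p^[m] v = p^[b] v') : ∃ c, m = b + c ∧ p^[c] v = v' := by
  induction b generalizing m with
  | zero => exact ⟨m, by omega, hm⟩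
  | succ b ih =>
    have hnB : ¬ B (p^[b + 1] v') := not_of_lt_segLen (by omega) hb
    have key : ∀ x, p x = p^[b + 1] v' → x ≠ r := by
      rintro x hx rfl
      rw [h.root] at hx
      exact hnB (hx ▸ hr)
    cases m with
    | zero => exact absurd (hm ▸ hv) hnB
    | succ m =>
      have h1 : p (p^[m] v) = p^[b + 1] v' := by rw [← hm, Function.iterate_succ_apply']
      have h2 : p (p^[b] v') = p^[b + 1] v' := by rw [Function.iterate_succ_apply']
      obtain ⟨c, hc, hc'⟩ := ih (by omega) ((hB _ hnB).unique ⟨key _ h1, h1⟩ ⟨key _ h2, h2⟩)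
      exact ⟨c, by omega, hc'⟩

theorem IsParentMap.segment_unique (h : IsParentMap T r p) (hr : B r)
    (hB : HasUniqueChild r p B) {v v' : V} (hv : B v) (hv' : B v') {a b : ℕ}
    (ha : a < segLen p B v) (hb : b < segLen p B v') (hab : p^[a] v = p^[b] v') :
    v = v' ∧ a = b := by
  obtain ⟨c, hc, hcv⟩ := h.exists_iterate_eq_of_iterate_eq hr hB hv hb hab
  have hc0 : c = 0 := by
    by_contra hc0
    exact not_of_lt_segLen (p := p) (B := B) (v := v) (s := c) (by omega) (by omega) (hcv ▸ hv')
  subst hc0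
  exact ⟨hcv, by omega⟩

/-- Descend from `w` through only children until `B` is met; bounded depth makes this stop. -/
theorem IsParentMap.exists_segment [Finite V] (h : IsParentMap T r p) (hr : B r)
    (hB : HasUniqueChild r p B) (w : V) (hw : w ≠ r) :
    ∃ v, v ≠ r ∧ B v ∧ ∃ a < segLen p B v, p^[a] v = w := by
  obtain ⟨D, hD⟩ := (Set.finite_range (T.dist r)).bddAbove
  have hD' : ∀ x, T.dist r x ≤ D := fun x => hD ⟨x, rfl⟩
  induction hn : D - T.dist r w generalizing w with
  | zero =>
    by_cases hBw : B w
    · exact ⟨w, hw, hBw, 0, (h.segLen_spec hr w).1, rfl⟩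
    · obtain ⟨u, ⟨hu, hpu⟩, -⟩ := hB w hBw
      have := h.dist_parent u hu
      rw [hpu] at this
      have := hD' u
      omega
  | succ n ih =>
    by_cases hBw : B w
    · exact ⟨w, hw, hBw, 0, (h.segLen_spec hr w).1, rfl⟩
    · obtain ⟨u, ⟨hu, hpu⟩, -⟩ := hB w hBw
      have h1 := h.dist_parent u hu
      rw [hpu] at h1
      obtain ⟨v, hv, hBv, a, ha, hav⟩ := ih u hu (by omega)
      have haw : p^[a + 1] v = w := by rw [Function.iterate_succ_apply', hav, hpu]
      refine ⟨v, hv, hBv, a + 1, ?_, haw⟩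
      by_contra hlt
      have : segLen p B v = a + 1 := by omega
      have h2 := (h.segLen_spec hr v).2
      rw [this, haw] at h2
      exact hBw h2

theorem IsParentMap.segLen_le_of_isAncestor (h : IsParentMap T r p) {v v' : V}
    (hv : B v) (hne : v ≠ v') (hvv : IsAncestor p v v') : segLen p B v' ≤ T.dist v v' := by
  obtain ⟨j, hj⟩ := hvv
  have h1 := h.iterate_dist hj
  exact segLen_le (h.connected.pos_dist_of_ne hne) (by rw [h1]; exact hv)

/-- The segment of `v'` ends no higher than `v`, because `v` is in `B`; the extreme case is that
they meet at `v`. -/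
theorem IsParentMap.dist_segments_of_isAncestor (h : IsParentMap T r p) (hr : B r)
    {v v' : V} (hv : B v) (hvr : v ≠ r) (hne : v ≠ v') (hvv : IsAncestor p v v')
    {a b : ℕ} (ha : a < segLen p B v) (hb : b < segLen p B v') :
    IsAncestor p (p^[a] v) (p^[b] v') ∧
      a + (segLen p B v' - b) ≤ T.dist (p^[a] v) (p^[b] v') := by
  have hs := h.segLen_le_of_isAncestor hv hne hvv
  have h1 := h.dist_of_isAncestor hvv
  have h2 := h.lt_dist_of_lt_segLen hr hvr ha
  have hanc : IsAncestor p (p^[a] v) (p^[b] v') := by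
    obtain ⟨j, hj⟩ := hvv
    have h3 := h.iterate_dist hj
    refine ⟨a + T.dist v v' - b, ?_⟩
    rw [← Function.iterate_add_apply, Nat.sub_add_cancel (by omega), Function.iterate_add_apply, h3]
  refine ⟨hanc, ?_⟩
  have h3 := h.dist_of_isAncestor hanc
  rw [h.dist_root_iterate, h.dist_root_iterate] at h3
  omega

theorem IsParentMap.not_isAncestor_segments (h : IsParentMap T r p) (hr : B r)
    (hB : HasUniqueChild r p B) {v v' : V} (hv : B v) (hvv : ¬ IsAncestor p v' v)
    {b : ℕ} (hb : b < segLen p B v') (a : ℕ) : ¬ IsAncestor p (p^[b] v') (p^[a] v) := by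
  rintro ⟨m, hm⟩
  rw [← Function.iterate_add_apply] at hm
  obtain ⟨c, -, hc⟩ := h.exists_iterate_eq_of_iterate_eq hr hB hv hb hm
  exact hvv ⟨c, hc⟩

/-- Neither segment is below the other, so the path climbs each of them to its top and then joins
the tops. -/
theorem IsParentMap.dist_segments_of_not_isAncestor (h : IsParentMap T r p) (hr : B r)
    (hB : HasUniqueChild r p B) {v v' : V} (hv : B v) (hv' : B v')
    (h1 : ¬ IsAncestor p v v') (h2 : ¬ IsAncestor p v' v)
    {a b : ℕ} (ha : a < segLen p B v) (hb : b < segLen p B v') :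
    T.dist (p^[a] v) (p^[b] v') = (segLen p B v - a) + (segLen p B v' - b) +
      T.dist (p^[segLen p B v] v) (p^[segLen p B v'] v') := by
  rw [h.dist_of_forall_not_isAncestor (segLen p B v - a), ← Function.iterate_add_apply,
    Nat.sub_add_cancel ha.le, dist_comm,
    h.dist_of_forall_not_isAncestor (segLen p B v' - b), ← Function.iterate_add_apply,
    Nat.sub_add_cancel hb.le, dist_comm]
  · omega
  · intro i hi
    rw [← Function.iterate_add_apply]
    exact h.not_isAncestor_segments hr hB hv h2 (by omega) _
  · intro i hi
    rw [← Function.iterate_add_apply]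
    exact h.not_isAncestor_segments hr hB hv' h1 (by omega) _

theorem IsParentMap.dist_same_segment (h : IsParentMap T r p) (hr : B r) {v : V} (hvr : v ≠ r)
    {a b : ℕ} (hab : a ≤ b) (hb : b < segLen p B v) :
    IsAncestor p (p^[b] v) (p^[a] v) ∧ T.dist (p^[b] v) (p^[a] v) = b - a := by
  have hanc : IsAncestor p (p^[b] v) (p^[a] v) := by
    refine ⟨b - a, ?_⟩
    rw [← Function.iterate_add_apply, Nat.sub_add_cancel hab]
  have h3 := h.dist_of_isAncestor hanc
  have := h.lt_dist_of_lt_segLen hr hvr hb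
  rw [h.dist_root_iterate, h.dist_root_iterate] at h3
  exact ⟨hanc, by omega⟩

/-- The segments are indexed by the vertices of `B` other than the root. -/
abbrev SegIndex (r : V) (B : V → Prop) : Type _ := {v : V // v ≠ r ∧ B v}

/-- The vertices other than the root, sorted by the segment to which the edge to their parent
belongs. -/
noncomputable def IsParentMap.segmentEquiv [Finite V] (h : IsParentMap T r p) (hr : B r)
    (hB : HasUniqueChild r p B) :
    (Σ v : SegIndex r B, Fin (segLen p B v.1)) ≃ {w : V // w ≠ r} :=
  Equiv.ofBijective (fun x => ⟨p^[x.2.val] x.1.1, h.iterate_ne_root hr x.1.2.1 x.2.isLt⟩) <| by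
    constructor
    · rintro ⟨⟨v, hv⟩, a⟩ ⟨⟨v', hv'⟩, b⟩ hab
      obtain ⟨rfl, hab'⟩ := h.segment_unique hr hB hv.2 hv'.2 a.isLt b.isLt (congrArg Subtype.val hab)
      obtain rfl : a = b := Fin.ext hab'
      rfl
    · rintro ⟨w, hw⟩
      obtain ⟨v, hv, hBv, a, ha, haw⟩ := h.exists_segment hr hB w hw
      exact ⟨⟨⟨v, hv, hBv⟩, ⟨a, ha⟩⟩, Subtype.ext haw⟩

@[simp] theorem IsParentMap.segmentEquiv_apply [Finite V] (h : IsParentMap T r p) (hr : B r)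
    (hB : HasUniqueChild r p B) (x : Σ v : SegIndex r B, Fin (segLen p B v.1)) :
    (h.segmentEquiv hr hB x : V) = p^[x.2.val] x.1.1 := rfl

/-- The top `t` lies below at most one of two children of the root. The segment through the edge
from the other child to `r` has top `r ≠ t` and is incomparable with that of `v`. This is the source
of strictness in the equality case. -/
theorem IsParentMap.exists_dist_top_ne_zero [Finite V] (h : IsParentMap T r p) (hr : B r)
    (hB : HasUniqueChild r p B) {c₁ c₂ : V} (hc₁ : c₁ ≠ r) (hc₂ : c₂ ≠ r) (hc : c₁ ≠ c₂)
    (hp₁ : p c₁ = r) (hp₂ : p c₂ = r) {v : V} (hvr : v ≠ r) (hv : B v)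
    (ht : p^[segLen p B v] v ≠ r) :
    ∃ v', v' ≠ r ∧ B v' ∧ ¬ IsAncestor p v v' ∧ ¬ IsAncestor p v' v ∧
      T.dist (p^[segLen p B v] v) (p^[segLen p B v'] v') ≠ 0 := by
  set t := p^[segLen p B v] v with htdef
  have key : ∀ c, c ≠ r → p c = r → ¬ IsAncestor p c t →
      ∃ v', v' ≠ r ∧ B v' ∧ ¬ IsAncestor p v v' ∧ ¬ IsAncestor p v' v ∧
      T.dist t (p^[segLen p B v'] v') ≠ 0 := by
    intro c hcr hpc hct
    obtain ⟨v', hvr', hv', a, ha, hav⟩ := h.exists_segment hr hB c hcr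
    have htop : p^[a + 1] v' = r := by rw [Function.iterate_succ_apply', hav, hpc]
    have hs : segLen p B v' = a + 1 := by
      have := segLen_le (p := p) (B := B) (v := v') (s := a + 1) (by omega) (htop ▸ hr)
      omega
    have hne : v ≠ v' := by
      rintro rfl
      rw [hs] at htdef
      exact ht (htdef.trans htop)
    refine ⟨v', hvr', hv', fun hvv => ?_, fun hvv => ?_, ?_⟩
    · have h1 := h.segLen_le_of_isAncestor hv hne hvv
      have h2 := (h.iterate_eq_root_iff _ _).1 htop
      have h3 := h.dist_of_isAncestor hvv
      have h4 := h.connected.pos_dist_of_ne hvr.symm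
      omega
    · have h1 := h.segLen_le_of_isAncestor hv' hne.symm hvv
      apply hct
      refine IsAncestor.trans ⟨a, hav⟩ ⟨T.dist v' v - segLen p B v, ?_⟩
      obtain ⟨j, hj⟩ := hvv
      rw [htdef, ← Function.iterate_add_apply, Nat.sub_add_cancel h1, h.iterate_dist hj]
    · rw [hs, htop, Ne, h.connected.dist_eq_zero_iff]
      exact ht
  by_cases h1 : IsAncestor p c₁ t
  · refine key c₂ hc₂ hp₂ fun h2 => hc ?_
    obtain ⟨i, hi⟩ := h1
    obtain ⟨j, hj⟩ := h2
    have hd : ∀ c, c ≠ r → p c = r → T.dist r c = 1 := fun c hcr hpc =>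
      dist_eq_one_iff_adj.mpr (hpc ▸ (h.adj_parent hcr).symm)
    have e1 := h.dist_root_iterate i t
    have e2 := h.dist_root_iterate j t
    rw [hi, hd _ hc₁ hp₁] at e1
    rw [hj, hd _ hc₂ hp₂] at e2
    rw [← hi, ← hj, show i = j by omega]
  · exact key c₁ hc₁ hp₁ h1

end SimpleGraph

/-! ### The Harary index as a sum over pairs of edges, and its bound by segment lengths. -/

/-- The sum of `1 / d` over the pairs of edges of a path with `s` edges, where `d` is the number of
edges of the path spanned by the two edges. -/
noncomputable def samePathSum (s : ℕ) : ℝ :=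
  ∑ a ∈ Finset.range s, ∑ b ∈ Finset.range s, 1 / (|(a : ℝ) - b| + 1)

/-- The sum of `1 / d` over the pairs of edges of two paths with `s` and `t` edges that share an end,
where `d` is the number of edges of the path spanned by the two edges. -/
noncomputable def twoPathSum (s t : ℕ) : ℝ :=
  ∑ a ∈ Finset.range s, ∑ b ∈ Finset.range t, 1 / ((a : ℝ) + b + 2)

theorem twoPathSum_comm (s t : ℕ) : twoPathSum s t = twoPathSum t s := by
  unfold twoPathSum
  rw [Finset.sum_comm]
  exact Finset.sum_congr rfl fun a _ => Finset.sum_congr rfl fun b _ => by rw [add_comm (b : ℝ)]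

/-- The Harary index of a starlike tree in terms of the lengths of its legs. -/
noncomputable def starlikeSum {ι : Type*} [Fintype ι] (s : ι → ℕ) : ℝ :=
  open Classical in
  (1 / 2) * (∑ i, (s i : ℝ) + ∑ i, ∑ j, if i = j then samePathSum (s i) else twoPathSum (s i) (s j))

namespace SimpleGraph

variable {V : Type*} {T : SimpleGraph V} {r : V} {p : V → V} {B : V → Prop}

open Classical in
/-- The number of edges of the path spanned by the edges from `u` and `w` to their parents. -/
noncomputable def edgeSpan (T : SimpleGraph V) (p : V → V) (u w : V) : ℕ :=
  if IsAncestor p u w ∨ IsAncestor p w u then T.dist u w + 1 else T.dist u w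

theorem edgeSpan_comm (u w : V) : edgeSpan T p u w = edgeSpan T p w u := by
  simp only [edgeSpan, dist_comm (u := w) (v := u)]
  split_ifs <;> tauto

-- Both sides are the harmonic sum up to the depth of `w`: moving each proper ancestor one step
-- towards `w` trades `d` for `d + 1` and removes the root.
open Classical in
theorem IsParentMap.sum_proper_ancestors [Fintype V] (h : IsParentMap T r p) (w : V) :
    ∑ u, (if IsAncestor p u w ∧ u ≠ w then 1 / (T.dist u w : ℝ) else 0) =
      ∑ u : {u // u ≠ r}, if IsAncestor p u w then 1 / ((T.dist u w : ℝ) + 1) else 0 := by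
  have inj : ∀ c ≤ 1, Set.InjOn (fun j => p^[j + c] w) (Finset.range (T.dist r w)) := by
    intro c hc i hi j hj hij
    simp only [Finset.coe_range, Set.mem_Iio] at hi hj
    have h1 := h.dist_iterate (j := i + c) (v := w) (by omega)
    have h2 := h.dist_iterate (j := j + c) (v := w) (by omega)
    simp only at hij
    rw [hij] at h1
    omega
  have e1 : ∑ j ∈ Finset.range (T.dist r w), 1 / ((j : ℝ) + 1) =
      ∑ u, (if IsAncestor p u w ∧ u ≠ w then 1 / (T.dist u w : ℝ) else 0) := by
    refine Finset.sum_of_injOn (fun j => p^[j + 1] w) (inj 1 le_rfl) (by simp [Set.MapsTo]) ?_ ?_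
    · intro u _ hu
      rw [if_neg]
      rintro ⟨⟨j, hj⟩, hne⟩
      apply hu
      have h1 := h.iterate_dist hj
      have h2 := h.dist_of_isAncestor ⟨j, hj⟩
      have h3 := h.connected.pos_dist_of_ne hne
      refine ⟨T.dist u w - 1, by simp; omega, ?_⟩
      simp only
      rw [Nat.sub_add_cancel h3, h1]
    · intro j hj
      have h1 := h.dist_iterate (j := j + 1) (v := w) (Finset.mem_range.1 hj)
      rw [if_pos, h1]
      · push_cast; rfl
      · refine ⟨⟨_, rfl⟩, fun h2 => ?_⟩
        rw [h2] at h1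
        simp at h1
  have e2 : ∑ j ∈ Finset.range (T.dist r w), 1 / ((j : ℝ) + 1) =
      ∑ u ∈ Finset.univ.filter (fun u => u ≠ r),
        if IsAncestor p u w then 1 / ((T.dist u w : ℝ) + 1) else 0 := by
    refine Finset.sum_of_injOn (fun j => p^[j] w) (inj 0 (by omega)) ?_ ?_ ?_
    · intro j hj
      have := Finset.mem_range.1 hj
      have h1 := h.iterate_eq_root_iff j w
      simp only [Finset.coe_filter, Finset.mem_univ, true_and, Set.mem_ofPred_eq, Ne, h1]
      omega
    · intro u hu' hu
      rw [if_neg]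
      rintro ⟨j, hj⟩
      apply hu
      have h1 := h.iterate_dist hj
      have h2 := h.dist_of_isAncestor ⟨j, hj⟩
      have h3 := h.connected.pos_dist_of_ne (Ne.symm (Finset.mem_filter.1 hu').2)
      exact ⟨T.dist u w, by simp; omega, h1⟩
    · intro j hj
      have h1 := h.dist_iterate (j := j) (v := w) (Finset.mem_range.1 hj).le
      rw [if_pos ⟨_, rfl⟩, h1]
  rw [← e1, e2]
  exact Finset.sum_subtype _ (by simp) _

open Classical in
theorem IsParentMap.two_mul_hararyIndex [Fintype V] (h : IsParentMap T r p) :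
    2 * T.hararyIndex = ((Fintype.card V : ℝ) - 1) +
      ∑ u : {u // u ≠ r}, ∑ w : {u // u ≠ r}, 1 / (edgeSpan T p u w : ℝ) := by
  -- `α` carries the comparable pairs of vertices, `β` the comparable pairs of edges, and `γ` the
  -- incomparable pairs, on which the two counts agree.
  set α : V → V → ℝ := fun u w => if IsAncestor p u w ∧ u ≠ w then 1 / (T.dist u w : ℝ) else 0
    with hα
  set β : V → V → ℝ := fun u w => if IsAncestor p u w then 1 / ((T.dist u w : ℝ) + 1) else 0 with hβ
  set γ : V → V → ℝ := fun u w =>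
    if ¬ IsAncestor p u w ∧ ¬ IsAncestor p w u then 1 / (T.dist u w : ℝ) else 0 with hγ
  have hR : ∀ u w, T.reciprocalDistMatrix u w = α u w + α w u + γ u w := by
    intro u w
    simp only [reciprocalDistMatrix, Matrix.of_apply, hα, hγ, dist_comm (u := w) (v := u)]
    by_cases huw : u = w
    · subst huw
      simp [IsAncestor.refl]
    · have := fun h1 h2 => huw (h.isAncestor_antisymm h1 h2)
      by_cases h1 : IsAncestor p u w <;> by_cases h2 : IsAncestor p w u
      · exact absurd h2 (this h1)
      all_goals simp [h1, h2, huw, Ne.symm huw]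
  -- On the diagonal `β` is counted twice; this correction is the origin of the summand `n - 1`.
  have hS : ∀ u w, 1 / (edgeSpan T p u w : ℝ) =
      β u w + β w u + γ u w - (if u = w then 1 else 0) := by
    intro u w
    simp only [edgeSpan, hβ, hγ, dist_comm (u := w) (v := u)]
    by_cases huw : u = w
    · subst huw
      simp [IsAncestor.refl]
    · have := fun h1 h2 => huw (h.isAncestor_antisymm h1 h2)
      by_cases h1 : IsAncestor p u w <;> by_cases h2 : IsAncestor p w u
      · exact absurd h2 (this h1)
      all_goals simp [h1, h2, huw]
  have hαr : ∀ u, α u r = 0 := by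
    intro u
    simp only [hα]
    rw [if_neg]
    rintro ⟨⟨j, hj⟩, hne⟩
    rw [h.iterate_root] at hj
    exact hne hj.symm
  have hγr : ∀ u, γ u r = 0 := fun u => if_neg fun hh => hh.2 (h.isAncestor_root u)
  have hγr' : ∀ u, γ r u = 0 := fun u => if_neg fun hh => hh.1 (h.isAncestor_root u)
  have hsum : ∀ f : V → ℝ, f r = 0 → ∑ u, f u = ∑ u : {u // u ≠ r}, f u := by
    intro f hf
    rw [Fintype.sum_eq_add_sum_subtype_ne f r, hf, zero_add]
  have hA : ∑ w, ∑ u, α u w = ∑ w : {u // u ≠ r}, ∑ u : {u // u ≠ r}, β u w := by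
    rw [hsum (fun w => ∑ u, α u w) (Finset.sum_eq_zero fun u _ => hαr u)]
    exact Finset.sum_congr rfl fun w _ => h.sum_proper_ancestors w
  have hG : ∑ u, ∑ w, γ u w = ∑ u : {u // u ≠ r}, ∑ w : {u // u ≠ r}, γ u w := by
    rw [hsum (fun u => ∑ w, γ u w) (Finset.sum_eq_zero fun u _ => hγr' u)]
    exact Finset.sum_congr rfl fun u _ => hsum _ (hγr u)
  have hD : ∑ u : {u // u ≠ r}, ∑ w : {u // u ≠ r}, (if (u : V) = w then (1 : ℝ) else 0) =
      (Fintype.card V : ℝ) - 1 := by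
    have h1 : Fintype.card {u // u ≠ r} = Fintype.card V - 1 := by
      rw [Fintype.card_subtype_compl, Fintype.card_subtype_eq]
    have h2 : 1 ≤ Fintype.card V := Fintype.card_pos_iff.2 ⟨r⟩
    simp only [Subtype.coe_inj, Finset.sum_ite_eq, Finset.mem_univ, if_true, Finset.sum_const,
      Finset.card_univ, nsmul_eq_mul, mul_one, h1]
    push_cast [h2]
    rfl
  have e : 2 * T.hararyIndex = ∑ u, ∑ w, T.reciprocalDistMatrix u w := by
    rw [hararyIndex]; ring
  rw [e]
  simp_rw [hR, hS, Finset.sum_sub_distrib, Finset.sum_add_distrib]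
  rw [hD, hG, Finset.sum_comm (f := fun u w => α u w), hA,
    Finset.sum_comm (f := fun (u w : {u // u ≠ r}) => β u w)]
  ring

/-- The sum of `1 / d` over the pairs of edges of two segments. -/
noncomputable def segmentSum (T : SimpleGraph V) (p : V → V) (B : V → Prop) (v v' : V) : ℝ :=
  ∑ a ∈ Finset.range (segLen p B v), ∑ b ∈ Finset.range (segLen p B v'),
    1 / (edgeSpan T p (p^[a] v) (p^[b] v') : ℝ)

theorem segmentSum_comm (v v' : V) : segmentSum T p B v v' = segmentSum T p B v' v := by
  unfold segmentSum
  rw [Finset.sum_comm]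
  simp_rw [edgeSpan_comm (T := T) (p := p)]

theorem IsParentMap.two_mul_hararyIndex_eq_sum_segmentSum [Fintype V] [Fintype (SegIndex r B)]
    (h : IsParentMap T r p) (hr : B r) (hB : HasUniqueChild r p B) :
    2 * T.hararyIndex = ((Fintype.card V : ℝ) - 1) +
      ∑ v : SegIndex r B, ∑ v' : SegIndex r B, segmentSum T p B v v' := by
  classical
  rw [h.two_mul_hararyIndex]
  congr 1
  have key : ∀ f : {u // u ≠ r} → ℝ, ∑ u, f u = ∑ v : SegIndex r B,
      ∑ a : Fin (segLen p B v.1), f (h.segmentEquiv hr hB ⟨v, a⟩) := by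
    intro f
    rw [← (h.segmentEquiv hr hB).sum_comp, Fintype.sum_sigma]
  rw [key]
  refine Finset.sum_congr rfl fun v _ => ?_
  simp_rw [key, segmentEquiv_apply]
  rw [Finset.sum_comm]
  refine Finset.sum_congr rfl fun v' _ => ?_
  rw [segmentSum, Finset.sum_range]
  refine Finset.sum_congr rfl fun a _ => ?_
  rw [Finset.sum_range]

theorem IsParentMap.sum_segLen [Fintype V] [Fintype (SegIndex r B)]
    (h : IsParentMap T r p) (hr : B r) (hB : HasUniqueChild r p B) :
    ∑ v : SegIndex r B, segLen p B v.1 = Fintype.card V - 1 := by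
  classical
  have := Fintype.card_congr (h.segmentEquiv hr hB)
  rw [Fintype.card_sigma, Fintype.card_subtype_compl, Fintype.card_subtype_eq] at this
  simpa using this

theorem IsParentMap.segmentSum_self (h : IsParentMap T r p) (hr : B r) {v : V} (hvr : v ≠ r) :
    segmentSum T p B v v = samePathSum (segLen p B v) := by
  have key : ∀ a b, a ≤ b → b < segLen p B v →
      (edgeSpan T p (p^[a] v) (p^[b] v) : ℝ) = |(a : ℝ) - b| + 1 := by
    intro a b hab hb
    obtain ⟨h1, h2⟩ := h.dist_same_segment hr hvr hab hb
    rw [edgeSpan, if_pos (Or.inr h1), dist_comm, h2, abs_sub_comm, abs_of_nonneg]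
    · push_cast [hab]; ring
    · have : (a : ℝ) ≤ b := by exact_mod_cast hab
      linarith
  refine Finset.sum_congr rfl fun a ha => Finset.sum_congr rfl fun b hb => ?_
  rw [Finset.mem_range] at ha hb
  rcases le_total a b with hab | hab
  · rw [key a b hab hb]
  · rw [edgeSpan_comm, key b a hab ha, abs_sub_comm]

theorem IsParentMap.segmentSum_le_of_isAncestor (h : IsParentMap T r p) (hr : B r)
    {v v' : V} (hv : B v) (hvr : v ≠ r) (hne : v ≠ v') (hvv : IsAncestor p v v') :
    segmentSum T p B v v' ≤ twoPathSum (segLen p B v) (segLen p B v') := by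
  unfold segmentSum twoPathSum
  refine Finset.sum_le_sum fun a ha => ?_
  -- Positions in the segment of `v` already count from the potential common end `v`; those in the
  -- segment of `v'` are reversed to count from its top.
  rw [← Finset.sum_range_reflect]
  refine Finset.sum_le_sum fun b hb => ?_
  rw [Finset.mem_range] at ha hb
  obtain ⟨h1, h2⟩ := h.dist_segments_of_isAncestor hr hv hvr hne hvv ha
    (b := segLen p B v' - 1 - b) (by omega)
  rw [edgeSpan, if_pos (Or.inl h1)]
  apply one_div_le_one_div_of_le (by positivity)
  have : a + b + 2 ≤ T.dist (p^[a] v) (p^[segLen p B v' - 1 - b] v') + 1 := by omega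
  exact_mod_cast this

theorem IsParentMap.segmentSum_of_not_isAncestor (h : IsParentMap T r p) (hr : B r)
    (hB : HasUniqueChild r p B) {v v' : V} (hv : B v) (hv' : B v')
    (h1 : ¬ IsAncestor p v v') (h2 : ¬ IsAncestor p v' v) :
    segmentSum T p B v v' = ∑ a ∈ Finset.range (segLen p B v),
      ∑ b ∈ Finset.range (segLen p B v'), 1 / ((a : ℝ) + b + 2 +
        T.dist (p^[segLen p B v] v) (p^[segLen p B v'] v')) := by
  unfold segmentSum
  rw [← Finset.sum_range_reflect]
  refine Finset.sum_congr rfl fun a ha => ?_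
  rw [← Finset.sum_range_reflect]
  refine Finset.sum_congr rfl fun b hb => ?_
  rw [Finset.mem_range] at ha hb
  have ha' : segLen p B v - 1 - a < segLen p B v := by omega
  have hb' : segLen p B v' - 1 - b < segLen p B v' := by omega
  have h3 := h.dist_segments_of_not_isAncestor hr hB hv hv' h1 h2 ha' hb'
  rw [edgeSpan, if_neg, h3]
  · have e1 : segLen p B v - (segLen p B v - 1 - a) = a + 1 := by omega
    have e2 : segLen p B v' - (segLen p B v' - 1 - b) = b + 1 := by omega
    rw [e1, e2]
    push_cast
    congr 1
    ring
  · rintro (h4 | h4)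
    · exact h.not_isAncestor_segments hr hB hv' h1 ha' _ h4
    · exact h.not_isAncestor_segments hr hB hv h2 hb' _ h4

theorem IsParentMap.segmentSum_le (h : IsParentMap T r p) (hr : B r)
    (hB : HasUniqueChild r p B) {v v' : V} (hv : B v) (hv' : B v')
    (hvr : v ≠ r) (hvr' : v' ≠ r) (hne : v ≠ v') :
    segmentSum T p B v v' ≤ twoPathSum (segLen p B v) (segLen p B v') := by
  by_cases h1 : IsAncestor p v v'
  · exact h.segmentSum_le_of_isAncestor hr hv hvr hne h1
  by_cases h2 : IsAncestor p v' v
  · rw [segmentSum_comm, twoPathSum_comm]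
    exact h.segmentSum_le_of_isAncestor hr hv' hvr' hne.symm h2
  rw [h.segmentSum_of_not_isAncestor hr hB hv hv' h1 h2]
  refine Finset.sum_le_sum fun a _ => Finset.sum_le_sum fun b _ => ?_
  apply one_div_le_one_div_of_le (by positivity)
  simp

theorem IsParentMap.segmentSum_lt (h : IsParentMap T r p) (hr : B r)
    (hB : HasUniqueChild r p B) {v v' : V} (hv : B v) (hv' : B v')
    (h1 : ¬ IsAncestor p v v') (h2 : ¬ IsAncestor p v' v)
    (h3 : T.dist (p^[segLen p B v] v) (p^[segLen p B v'] v') ≠ 0) :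
    segmentSum T p B v v' < twoPathSum (segLen p B v) (segLen p B v') := by
  rw [h.segmentSum_of_not_isAncestor hr hB hv hv' h1 h2]
  refine Finset.sum_lt_sum_of_nonempty ?_ fun a _ => Finset.sum_lt_sum_of_nonempty ?_ fun b _ => ?_
  · exact Finset.nonempty_range_iff.2 (by have := (h.segLen_spec hr v).1; omega)
  · exact Finset.nonempty_range_iff.2 (by have := (h.segLen_spec hr v').1; omega)
  · apply one_div_lt_one_div_of_lt (by positivity)
    have : (0 : ℝ) < T.dist (p^[segLen p B v] v) (p^[segLen p B v'] v') := by
      exact_mod_cast Nat.pos_of_ne_zero h3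
    linarith

theorem IsParentMap.hararyIndex_le_starlikeSum [Fintype V] [Fintype (SegIndex r B)]
    (h : IsParentMap T r p) (hr : B r) (hB : HasUniqueChild r p B) :
    T.hararyIndex ≤ starlikeSum (fun v : SegIndex r B => segLen p B v.1) ∧
      (T.hararyIndex = starlikeSum (fun v : SegIndex r B => segLen p B v.1) →
        ∀ v v' : SegIndex r B, v ≠ v' →
          segmentSum T p B v v' = twoPathSum (segLen p B v.1) (segLen p B v'.1)) := by
  classical
  have e1 := h.two_mul_hararyIndex_eq_sum_segmentSum hr hB
  have e2 : 2 * starlikeSum (fun v : SegIndex r B => segLen p B v.1) = ((Fintype.card V : ℝ) - 1) +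
      ∑ v : SegIndex r B, ∑ v' : SegIndex r B, if v = v' then samePathSum (segLen p B v.1)
        else twoPathSum (segLen p B v.1) (segLen p B v'.1) := by
    have h1 := h.sum_segLen hr hB
    have h2 : 1 ≤ Fintype.card V := Fintype.card_pos_iff.2 ⟨r⟩
    have h3 : ∑ v : SegIndex r B, (segLen p B v.1 : ℝ) = (Fintype.card V : ℝ) - 1 := by
      rw [← Nat.cast_sum, h1]
      push_cast [h2]
      rfl
    rw [starlikeSum, ← h3, ← mul_assoc]
    norm_num
    congr!
  have hle : ∀ v v' : SegIndex r B, segmentSum T p B v v' ≤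
      if v = v' then samePathSum (segLen p B v.1)
        else twoPathSum (segLen p B v.1) (segLen p B v'.1) := by
    intro v v'
    split_ifs with hvv
    · subst hvv
      exact (h.segmentSum_self hr v.2.1).le
    · exact h.segmentSum_le hr hB v.2.2 v'.2.2 v.2.1 v'.2.1 fun hh => hvv (Subtype.ext hh)
  have hle' : ∀ v : SegIndex r B, _ := fun v =>
    Finset.sum_le_sum (s := Finset.univ) fun v' _ => hle v v'
  refine ⟨?_, fun heq v v' hne => ?_⟩
  · have := Finset.sum_le_sum (s := Finset.univ) fun v _ => hle' v
    linarith
  · have h1 := (Finset.sum_eq_sum_iff_of_le fun v _ => hle' v).1 (by linarith) v (Finset.mem_univ _)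
    have h2 := (Finset.sum_eq_sum_iff_of_le fun v' _ => hle v v').1 h1 v' (Finset.mem_univ _)
    rwa [if_neg hne] at h2

end SimpleGraph

/-! ### Optimising the leg lengths. -/

theorem samePathSum_add (s t : ℕ) :
    samePathSum (s + t) = samePathSum s + samePathSum t + 2 * twoPathSum s t := by
  have h1 : ∑ a ∈ Finset.range s, ∑ b ∈ Finset.range t, 1 / (|(a : ℝ) - ((s + b : ℕ) : ℝ)| + 1) =
      twoPathSum s t := by
    rw [← Finset.sum_range_reflect]
    refine Finset.sum_congr rfl fun a ha => Finset.sum_congr rfl fun b _ => ?_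
    have e : s - 1 - a + (a + 1) = s := by have := Finset.mem_range.1 ha; omega
    have e' : ((s - 1 - a : ℕ) : ℝ) + (a + 1) = s := by exact_mod_cast e
    rw [abs_sub_comm, Nat.cast_add, ← e', abs_of_nonneg (by ring_nf; positivity)]
    ring_nf
  have h2 : ∑ b ∈ Finset.range t, ∑ a ∈ Finset.range s, 1 / (|((s + b : ℕ) : ℝ) - (a : ℝ)| + 1) =
      twoPathSum s t := by
    rw [Finset.sum_comm, ← h1]
    simp_rw [abs_sub_comm]
  simp only [samePathSum, Finset.sum_range_add, Finset.sum_add_distrib] at h1 h2 ⊢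
  rw [h1, h2]
  simp only [Nat.cast_add, add_sub_add_left_eq_sub]
  ring

/-- The extra edge on the shorter leg is nearer to the leg of length `c`. -/
theorem twoPathSum_exchange {a b c : ℕ} (hab : b < a) (hc : 1 ≤ c) :
    twoPathSum (a + 1) c + twoPathSum b c < twoPathSum a c + twoPathSum (b + 1) c := by
  have : ∑ y ∈ Finset.range c, 1 / ((a : ℝ) + y + 2) < ∑ y ∈ Finset.range c, 1 / ((b : ℝ) + y + 2) := by
    refine Finset.sum_lt_sum_of_nonempty (Finset.nonempty_range_iff.2 (by omega)) fun y _ => ?_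
    apply one_div_lt_one_div_of_lt (by positivity)
    have : (b : ℝ) < a := by exact_mod_cast hab
    linarith
  simp only [twoPathSum, Finset.sum_range_succ]
  linarith

theorem starlikeSum_comp {ι κ : Type*} [Fintype ι] [Fintype κ] (e : ι ≃ κ) (s : κ → ℕ) :
    starlikeSum (s ∘ e) = starlikeSum s := by
  classical
  unfold starlikeSum
  congr 2
  · exact e.sum_comp (fun i => (s i : ℝ))
  · rw [← e.sum_comp]
    refine Finset.sum_congr rfl fun i _ => ?_
    rw [← e.sum_comp]
    refine Finset.sum_congr rfl fun j _ => ?_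
    simp [e.injective.eq_iff]

-- Two legs form one path, so their joint contribution depends only on `s i + s j`. This isolates
-- the interaction with the other legs, all that an exchange changes.
open Classical in
theorem two_mul_starlikeSum_eq {ι : Type*} [Fintype ι] (s : ι → ℕ) {i j : ι} (hij : i ≠ j) :
    2 * starlikeSum s = ∑ m, (s m : ℝ) + samePathSum (s i + s j) +
      2 * ∑ m ∈ (Finset.univ.erase i).erase j, (twoPathSum (s i) (s m) + twoPathSum (s j) (s m)) +
      ∑ l ∈ (Finset.univ.erase i).erase j, ∑ m ∈ (Finset.univ.erase i).erase j,
        if l = m then samePathSum (s l) else twoPathSum (s l) (s m) := by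
  set R := (Finset.univ.erase i).erase j with hR
  have hsum : ∀ f : ι → ℝ, ∑ m, f m = f i + f j + ∑ m ∈ R, f m := by
    intro f
    rw [← Finset.add_sum_erase _ f (Finset.mem_univ i),
      ← Finset.add_sum_erase (Finset.univ.erase i) f (by simp [hij.symm] : j ∈ Finset.univ.erase i)]
    ring
  have hmi : ∀ m ∈ R, m ≠ i ∧ m ≠ j := by
    intro m hm
    simp only [hR, Finset.mem_erase] at hm
    exact ⟨hm.2.1, hm.1⟩
  have e1 : ∑ m ∈ R, (if i = m then samePathSum (s i) else twoPathSum (s i) (s m)) =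
      ∑ m ∈ R, twoPathSum (s i) (s m) :=
    Finset.sum_congr rfl fun m hm => if_neg (hmi m hm).1.symm
  have e2 : ∑ m ∈ R, (if j = m then samePathSum (s j) else twoPathSum (s j) (s m)) =
      ∑ m ∈ R, twoPathSum (s j) (s m) :=
    Finset.sum_congr rfl fun m hm => if_neg (hmi m hm).2.symm
  have e3 : ∑ m ∈ R, (if m = i then samePathSum (s m) else twoPathSum (s m) (s i)) =
      ∑ m ∈ R, twoPathSum (s i) (s m) :=
    Finset.sum_congr rfl fun m hm => by rw [if_neg (hmi m hm).1, twoPathSum_comm]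
  have e4 : ∑ m ∈ R, (if m = j then samePathSum (s m) else twoPathSum (s m) (s j)) =
      ∑ m ∈ R, twoPathSum (s j) (s m) :=
    Finset.sum_congr rfl fun m hm => by rw [if_neg (hmi m hm).2, twoPathSum_comm]
  rw [starlikeSum, samePathSum_add]
  simp_rw [hsum (fun m => if _ = m then _ else _)]
  rw [hsum (fun l => (if l = i then samePathSum (s l) else twoPathSum (s l) (s i)) +
    (if l = j then samePathSum (s l) else twoPathSum (s l) (s j)) +
    ∑ m ∈ R, if l = m then samePathSum (s l) else twoPathSum (s l) (s m))]
  simp only [Finset.sum_add_distrib, e1, e2, e3, e4, if_true, if_neg hij, if_neg hij.symm]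
  rw [twoPathSum_comm (s j) (s i)]
  ring

-- Strictness comes from a third leg; with two legs alone the sum would stay constant.
open Classical in
theorem starlikeSum_lt_exchange {ι : Type*} [Fintype ι] {s s' : ι → ℕ} {i j : ι} (hij : i ≠ j)
    (hcard : 3 ≤ Fintype.card ι) (hs : ∀ m, 1 ≤ s m) (hlt : s j + 2 ≤ s i)
    (hi : s' i + 1 = s i) (hj : s' j = s j + 1) (hm : ∀ m, m ≠ i → m ≠ j → s' m = s m) :
    ∑ m, s' m = ∑ m, s m ∧ starlikeSum s < starlikeSum s' := by
  have hR : ∀ m ∈ (Finset.univ.erase i).erase j, s' m = s m := by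
    intro m hmem
    simp only [Finset.mem_erase] at hmem
    exact hm m hmem.2.1 hmem.1
  have hjmem : j ∈ Finset.univ.erase i := by simp [hij.symm]
  have hsum : ∑ m, s' m = ∑ m, s m := by
    rw [← Finset.add_sum_erase _ s (Finset.mem_univ i), ← Finset.add_sum_erase _ s hjmem,
      ← Finset.add_sum_erase _ s' (Finset.mem_univ i), ← Finset.add_sum_erase _ s' hjmem,
      Finset.sum_congr rfl hR, hj, ← hi]
    ring
  refine ⟨hsum, ?_⟩
  have h1 := two_mul_starlikeSum_eq s hij
  have h2 := two_mul_starlikeSum_eq s' hij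
  have hsum' : ∑ m, (s' m : ℝ) = ∑ m, (s m : ℝ) := by exact_mod_cast hsum
  have hne : ((Finset.univ.erase i).erase j).Nonempty := by
    rw [← Finset.card_pos, Finset.card_erase_of_mem hjmem,
      Finset.card_erase_of_mem (Finset.mem_univ i), Finset.card_univ]
    omega
  have h3 : ∑ m ∈ (Finset.univ.erase i).erase j, (twoPathSum (s i) (s m) + twoPathSum (s j) (s m)) <
      ∑ m ∈ (Finset.univ.erase i).erase j, (twoPathSum (s' i) (s' m) + twoPathSum (s' j) (s' m)) := by
    refine Finset.sum_lt_sum_of_nonempty hne fun m hmem => ?_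
    rw [hR m hmem, hj, ← hi]
    exact twoPathSum_exchange (by omega) (hs m)
  have h4 : ∑ l ∈ (Finset.univ.erase i).erase j, ∑ m ∈ (Finset.univ.erase i).erase j,
        (if l = m then samePathSum (s' l) else twoPathSum (s' l) (s' m)) =
      ∑ l ∈ (Finset.univ.erase i).erase j, ∑ m ∈ (Finset.univ.erase i).erase j,
        if l = m then samePathSum (s l) else twoPathSum (s l) (s m) :=
    Finset.sum_congr rfl fun l hl => Finset.sum_congr rfl fun m hmem => by rw [hR l hl, hR m hmem]
  rw [hsum', h4, show s' i + s' j = s i + s j by omega] at h2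
  linarith

/-- Only the minimum and its successor occur as values. Fewer than `k` entries are above the
minimum, so their number is the remainder modulo `k`. -/
theorem exists_perm_eq_balancedLength {n k : ℕ} {s : Fin k → ℕ} (hs : ∀ i j, s i ≤ s j + 1)
    (hsum : ∑ i, s i = n - 1) : ∃ e : Equiv.Perm (Fin k), s = balancedLength n k ∘ e := by
  rcases Nat.eq_zero_or_pos k with rfl | hk
  · exact ⟨1, funext fun i => i.elim0⟩
  obtain ⟨i₀, -, hi₀⟩ := Finset.exists_min_image Finset.univ s ⟨⟨0, hk⟩, Finset.mem_univ _⟩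
  have hval : ∀ i, s i = s i₀ + if s i = s i₀ + 1 then 1 else 0 := by
    intro i
    have h1 := hi₀ i (Finset.mem_univ i)
    have h2 := hs i i₀
    split_ifs <;> omega
  have hcount : n - 1 = (Finset.univ.filter fun i => s i = s i₀ + 1).card + k * s i₀ := by
    rw [← hsum, Finset.sum_congr rfl fun i _ => hval i, Finset.sum_add_distrib]
    simp
    ring
  have hlt : (Finset.univ.filter fun i => s i = s i₀ + 1).card < k := by
    conv_rhs => rw [← Fintype.card_fin k, ← Finset.card_univ]
    apply Finset.card_lt_card
    rw [Finset.filter_ssubset]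
    exact ⟨i₀, Finset.mem_univ _, by omega⟩
  have hmod : (n - 1) % k = (Finset.univ.filter fun i => s i = s i₀ + 1).card := by
    rw [hcount, Nat.add_mul_mod_self_left, Nat.mod_eq_of_lt hlt]
  have hdiv : (n - 1) / k = s i₀ := by
    rw [hcount, Nat.add_mul_div_left _ _ hk, Nat.div_eq_of_lt hlt, zero_add]
  have hcard : Fintype.card {i : Fin k // s i = s i₀ + 1} =
      Fintype.card {i : Fin k // i.val < (n - 1) % k} := by
    rw [Fintype.card_subtype, ← hmod, Fintype.card_subtype, Fin.card_filter_val_lt,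
      min_eq_right (Nat.mod_lt _ hk).le]
  let f := Fintype.equivOfCardEq hcard
  refine ⟨f.extendSubtype, funext fun i => ?_⟩
  rw [hval i, Function.comp_apply, balancedLength, hdiv]
  congr 1
  by_cases hi : s i = s i₀ + 1
  · rw [if_pos hi, if_pos (f.extendSubtype_mem i hi)]
  · rw [if_neg hi, if_neg (f.extendSubtype_not_mem i hi)]

theorem le_add_one_of_isMax {k N : ℕ} (hk : k ≠ 2) {s : Fin k → ℕ} (hs : ∀ i, 1 ≤ s i)
    (hsum : ∑ i, s i = N)
    (hmax : ∀ s' : Fin k → ℕ, (∀ i, 1 ≤ s' i) → ∑ i, s' i = N → starlikeSum s' ≤ starlikeSum s)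
    (i j : Fin k) : s i ≤ s j + 1 := by
  by_contra hlt
  have hij : i ≠ j := by rintro rfl; omega
  have hk3 : 3 ≤ Fintype.card (Fin k) := by
    have h1 := i.isLt
    have h2 := j.isLt
    have h3 : i.val ≠ j.val := fun hh => hij (Fin.ext hh)
    rw [Fintype.card_fin]
    omega
  obtain ⟨h1, h2⟩ := starlikeSum_lt_exchange (s := s)
    (s' := Function.update (Function.update s i (s i - 1)) j (s j + 1)) hij hk3 hs (by omega)
    (by simp [hij]; omega) (by simp) (fun m hmi hmj => by simp [hmi, hmj])
  refine absurd (hmax _ (fun m => ?_) (h1.trans hsum)) (not_le.2 h2)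
  by_cases hmj : m = j
  · subst hmj; simp
  · by_cases hmi : m = i
    · subst hmi; simp [hmj]; omega
    · simpa [hmi, hmj] using hs m

/-- Exchanges need not be iterated: there are finitely many candidates, so a maximizer exists; every
maximizer is balanced, and balanced vectors agree up to permutation. -/
theorem starlikeSum_le_balancedLength {n k : ℕ} (hk : k ≠ 2) {ι : Type*} [Fintype ι]
    (hι : Fintype.card ι = k) {s : ι → ℕ} (hs : ∀ i, 1 ≤ s i) (hsum : ∑ i, s i = n - 1) :
    starlikeSum s ≤ starlikeSum (balancedLength n k) ∧
      (starlikeSum s = starlikeSum (balancedLength n k) →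
        ∃ e : ι ≃ Fin k, s = balancedLength n k ∘ e) := by
  let e₀ : Fin k ≃ ι := Fintype.equivOfCardEq (by simp [hι])
  have hs₀ : ∀ i, 1 ≤ (s ∘ e₀) i := fun i => hs _
  have hsum₀ : ∑ i, (s ∘ e₀) i = n - 1 := by rw [← hsum]; exact e₀.sum_comp s
  rw [← starlikeSum_comp e₀ s]
  obtain ⟨t, ht, htmax⟩ := Finset.exists_max_image
    ((Finset.piAntidiag Finset.univ (n - 1)).filter fun s : Fin k → ℕ => ∀ i, 1 ≤ s i) starlikeSum
    ⟨s ∘ e₀, by simp only [Finset.mem_filter, Finset.mem_piAntidiag]; exact ⟨⟨hsum₀, by simp⟩, hs₀⟩⟩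
  simp only [Finset.mem_filter, Finset.mem_piAntidiag] at ht htmax
  have htmax' : ∀ s' : Fin k → ℕ, (∀ i, 1 ≤ s' i) → ∑ i, s' i = n - 1 →
      starlikeSum s' ≤ starlikeSum t := fun s' h1 h2 => htmax s' ⟨⟨h2, by simp⟩, h1⟩
  obtain ⟨e, he⟩ := exists_perm_eq_balancedLength (le_add_one_of_isMax hk ht.2 ht.1.1 htmax') ht.1.1
  have htb : starlikeSum t = starlikeSum (balancedLength n k) := by rw [he, starlikeSum_comp]
  rw [← htb]
  refine ⟨htmax' _ hs₀ hsum₀, fun heq => ?_⟩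
  obtain ⟨e', he'⟩ := exists_perm_eq_balancedLength
    (le_add_one_of_isMax hk hs₀ hsum₀ (fun s' h1 h2 => heq ▸ htmax' s' h1 h2)) hsum₀
  refine ⟨e₀.symm.trans e', ?_⟩
  rw [Equiv.coe_trans, ← Function.comp_assoc, ← he', Function.comp_assoc, Equiv.self_comp_symm]
  rfl

/-! ### Distances, degrees and Harary index of starlike trees. -/

section starlike

variable {k : ℕ} {l : Fin k → ℕ}

theorem starlikeTree_adj_none_some (x : Σ i : Fin k, Fin (l i)) :
    (starlikeTree l).Adj none (some x) ↔ x.2.val = 0 := by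
  simp [starlikeTree]

theorem starlikeTree_adj_some_some (x y : Σ i : Fin k, Fin (l i)) :
    (starlikeTree l).Adj (some x) (some y) ↔
      x.1 = y.1 ∧ (x.2.val + 1 = y.2.val ∨ y.2.val + 1 = x.2.val) := by
  simp only [starlikeTree, SimpleGraph.fromRel_adj, Ne, Option.some.injEq]
  constructor
  · rintro ⟨-, ⟨h1, h2⟩ | ⟨h1, h2⟩⟩
    · exact ⟨h1, Or.inl h2⟩
    · exact ⟨h1.symm, Or.inr h2⟩
  · rintro ⟨h1, h2 | h2⟩
    · exact ⟨by rintro rfl; omega, Or.inl ⟨h1, h2⟩⟩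
    · exact ⟨by rintro rfl; omega, Or.inr ⟨h1.symm, h2⟩⟩

theorem starlikeTree_exists_walk_none (i : Fin k) (a : ℕ) (ha : a < l i) :
    ∃ w : (starlikeTree l).Walk none (some ⟨i, a, ha⟩), w.length = a + 1 := by
  induction a with
  | zero => exact ⟨((starlikeTree_adj_none_some _).2 rfl).toWalk, rfl⟩
  | succ a ih =>
    obtain ⟨w, hw⟩ := ih (by omega)
    exact ⟨w.concat ((starlikeTree_adj_some_some _ _).2 ⟨rfl, Or.inl rfl⟩), by
      rw [SimpleGraph.Walk.length_concat, hw]⟩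

theorem starlikeTree_connected (l : Fin k → ℕ) : (starlikeTree l).Connected := by
  rw [SimpleGraph.connected_iff_exists_forall_reachable]
  refine ⟨none, ?_⟩
  rintro (_ | ⟨i, a, ha⟩)
  · rfl
  · exact ⟨(starlikeTree_exists_walk_none i a ha).choose⟩

theorem starlikeTree_dist_none_le (i : Fin k) (a : Fin (l i)) :
    (starlikeTree l).dist none (some ⟨i, a⟩) ≤ a + 1 := by
  obtain ⟨w, hw⟩ := starlikeTree_exists_walk_none i a a.isLt
  exact hw ▸ SimpleGraph.dist_le w

theorem starlikeTree_dist_add_le (i : Fin k) (a d : ℕ) (had : a + d < l i) :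
    (starlikeTree l).dist (some ⟨i, a, by omega⟩) (some ⟨i, a + d, had⟩) ≤ d := by
  induction d with
  | zero => simp
  | succ d ih =>
    have h1 := ih (by omega)
    have h2 : (starlikeTree l).dist (some ⟨i, a + d, by omega⟩) (some ⟨i, a + (d + 1), had⟩) = 1 :=
      SimpleGraph.dist_eq_one_iff_adj.2 ((starlikeTree_adj_some_some _ _).2 ⟨rfl, Or.inl rfl⟩)
    have h3 := (starlikeTree_connected l).dist_triangle (u := some ⟨i, a, by omega⟩)
      (v := some ⟨i, a + d, by omega⟩) (w := some ⟨i, a + (d + 1), had⟩)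
    omega

theorem starlikeTree_dist_same_leg_le (i : Fin k) (a b : Fin (l i)) :
    ((starlikeTree l).dist (some ⟨i, a⟩) (some ⟨i, b⟩) : ℝ) ≤ |(a : ℝ) - b| := by
  have key : ∀ a b : Fin (l i), a ≤ b →
      ((starlikeTree l).dist (some ⟨i, a⟩) (some ⟨i, b⟩) : ℝ) ≤ |(a : ℝ) - b| := by
    rintro ⟨a, ha⟩ ⟨b, hb⟩ hab
    rw [Fin.mk_le_mk] at hab
    obtain ⟨d, rfl⟩ := Nat.exists_eq_add_of_le hab
    have := starlikeTree_dist_add_le i a d hb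
    simpa using this
  rcases le_total a b with h | h
  · exact key a b h
  · rw [SimpleGraph.dist_comm, abs_sub_comm]
    exact key b a h

theorem starlikeTree_dist_le (i j : Fin k) (a : Fin (l i)) (b : Fin (l j)) :
    (starlikeTree l).dist (some ⟨i, a⟩) (some ⟨j, b⟩) ≤ a + b + 2 := by
  have h1 := starlikeTree_dist_none_le i a
  have h2 := starlikeTree_dist_none_le j b
  have h3 := (starlikeTree_connected l).dist_triangle (u := some ⟨i, a⟩)
      (v := none) (w := some ⟨j, b⟩)
  rw [SimpleGraph.dist_comm] at h1
  omega

theorem SimpleGraph.Connected.one_div_le_reciprocalDistMatrix {V : Type*} {G : SimpleGraph V}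
    (hG : G.Connected) {u v : V} (huv : u ≠ v) {f : ℝ} (hf : (G.dist u v : ℝ) ≤ f) :
    1 / f ≤ G.reciprocalDistMatrix u v := by
  simp only [reciprocalDistMatrix, Matrix.of_apply, if_neg huv]
  exact one_div_le_one_div_of_le (by exact_mod_cast hG.pos_dist_of_ne huv) hf

theorem SimpleGraph.reciprocalDistMatrix_self {V : Type*} (G : SimpleGraph V) (u : V) :
    G.reciprocalDistMatrix u u = 0 := by
  simp [reciprocalDistMatrix]

theorem SimpleGraph.reciprocalDistMatrix_comm {V : Type*} (G : SimpleGraph V) (u v : V) :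
    G.reciprocalDistMatrix u v = G.reciprocalDistMatrix v u := by
  by_cases h : u = v
  · rw [h]
  · simp [reciprocalDistMatrix, dist_comm (u := u) (v := v), h, Ne.symm h]

/-- Twice the Harary index of a path with `s` edges, counted by edges and by vertices with one end
as the centre. The diagonal terms `1 / |a - a|` are `0` by convention. -/
theorem add_samePathSum_eq (s : ℕ) :
    (s : ℝ) + samePathSum s = 2 * ∑ a ∈ Finset.range s, 1 / ((a : ℝ) + 1) +
      ∑ a ∈ Finset.range s, ∑ b ∈ Finset.range s, 1 / |(a : ℝ) - b| := by
  induction s with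
  | zero => simp [samePathSum]
  | succ s ih =>
    have h1 : samePathSum 1 = 1 := by simp [samePathSum]
    have h2 : twoPathSum s 1 = ∑ a ∈ Finset.range s, 1 / ((a : ℝ) + 1) + 1 / ((s : ℝ) + 1) - 1 := by
      rw [← Finset.sum_range_succ (fun a : ℕ => 1 / ((a : ℝ) + 1)), Finset.sum_range_succ', twoPathSum]
      simp only [Finset.sum_range_one]
      push_cast
      norm_num
      refine Finset.sum_congr rfl fun a _ => ?_
      congr 1
      ring
    have h3 : ∑ a ∈ Finset.range s, 1 / |(a : ℝ) - s| = ∑ a ∈ Finset.range s, 1 / ((a : ℝ) + 1) := by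
      rw [← Finset.sum_range_reflect]
      refine Finset.sum_congr rfl fun a ha => ?_
      have e : s - 1 - a + (a + 1) = s := by have := Finset.mem_range.1 ha; omega
      have e' : ((s - 1 - a : ℕ) : ℝ) + (a + 1) = s := by exact_mod_cast e
      rw [← e', abs_sub_comm, abs_of_nonneg (by ring_nf; positivity)]
      congr 1
      ring
    have h4 : ∑ a ∈ Finset.range s, 1 / |(s : ℝ) - a| = ∑ a ∈ Finset.range s, 1 / ((a : ℝ) + 1) := by
      rw [← h3]
      simp_rw [abs_sub_comm]
    rw [samePathSum_add, h1, h2]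
    simp only [Finset.sum_range_succ, Finset.sum_add_distrib, h3, h4, sub_self, abs_zero, div_zero]
    push_cast
    linarith

/-- Only this direction enters the final chain of inequalities, so upper bounds on distances, that
is explicit walks, suffice. -/
theorem starlikeSum_le_hararyIndex (l : Fin k → ℕ) :
    starlikeSum l ≤ (starlikeTree l).hararyIndex := by
  classical
  set R := (starlikeTree l).reciprocalDistMatrix with hR
  have e1 : 2 * (starlikeTree l).hararyIndex = 2 * ∑ i, ∑ a, R none (some ⟨i, a⟩) +
      ∑ i, ∑ j, ∑ a, ∑ b, R (some ⟨i, a⟩) (some ⟨j, b⟩) := by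
    have : ∀ x, R (some x) none = R none (some x) := fun x =>
      SimpleGraph.reciprocalDistMatrix_comm _ _ _
    rw [SimpleGraph.hararyIndex, ← hR]
    simp only [Fintype.sum_option, Fintype.sum_sigma, Finset.sum_add_distrib, this]
    rw [show R none none = 0 from SimpleGraph.reciprocalDistMatrix_self _ _]
    have : ∀ i, ∑ j, ∑ a, ∑ b, R (some ⟨i, a⟩) (some ⟨j, b⟩) =
        ∑ a, ∑ j, ∑ b, R (some ⟨i, a⟩) (some ⟨j, b⟩) := fun i => Finset.sum_comm
    simp only [this]
    ring
  have h0 : ∀ i, ∑ a ∈ Finset.range (l i), 1 / ((a : ℝ) + 1) ≤ ∑ a, R none (some ⟨i, a⟩) := by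
    intro i
    rw [Finset.sum_range]
    refine Finset.sum_le_sum fun a _ => ?_
    apply (starlikeTree_connected l).one_div_le_reciprocalDistMatrix (by simp)
    exact_mod_cast starlikeTree_dist_none_le i a
  have h1 : ∀ i, ∑ a ∈ Finset.range (l i), ∑ b ∈ Finset.range (l i), 1 / |(a : ℝ) - b| ≤
      ∑ a, ∑ b, R (some ⟨i, a⟩) (some ⟨i, b⟩) := by
    intro i
    rw [Finset.sum_range]
    refine Finset.sum_le_sum fun a _ => ?_
    rw [Finset.sum_range]
    refine Finset.sum_le_sum fun b _ => ?_
    by_cases hab : a = b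
    · subst hab
      simp [hR, SimpleGraph.reciprocalDistMatrix_self]
    · exact (starlikeTree_connected l).one_div_le_reciprocalDistMatrix (by simpa using hab)
        (starlikeTree_dist_same_leg_le i a b)
  have h2 : ∀ i j, i ≠ j → twoPathSum (l i) (l j) ≤ ∑ a, ∑ b, R (some ⟨i, a⟩) (some ⟨j, b⟩) := by
    intro i j hij
    rw [twoPathSum, Finset.sum_range]
    refine Finset.sum_le_sum fun a _ => ?_
    rw [Finset.sum_range]
    refine Finset.sum_le_sum fun b _ => ?_
    apply (starlikeTree_connected l).one_div_le_reciprocalDistMatrix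
      (by simp only [Ne, Option.some.injEq, Sigma.mk.injEq, not_and]; exact fun hh => absurd hh hij)
    exact_mod_cast starlikeTree_dist_le i j a b
  -- The second term turns the edge count of a leg into its vertex count; its harmonic part later
  -- cancels against the pairs with the centre in `h0`.
  have h3 : ∀ i j, (if i = j then samePathSum (l i) else twoPathSum (l i) (l j)) +
      (if i = j then (l i : ℝ) - 2 * ∑ a ∈ Finset.range (l i), 1 / ((a : ℝ) + 1) else 0) ≤
      ∑ a, ∑ b, R (some ⟨i, a⟩) (some ⟨j, b⟩) := by
    intro i j
    by_cases hij : i = j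
    · subst hij
      rw [if_pos rfl, if_pos rfl]
      have := add_samePathSum_eq (l i)
      have := h1 i
      linarith
    · rw [if_neg hij, if_neg hij, add_zero]
      exact h2 i j hij
  have h4 := Finset.sum_le_sum (s := Finset.univ) fun i _ =>
    Finset.sum_le_sum (s := Finset.univ) fun j _ => h3 i j
  have h5 := Finset.sum_le_sum (s := Finset.univ) fun i _ => h0 i
  simp only [Finset.sum_add_distrib, Finset.sum_ite_eq, Finset.mem_univ, if_true,
    Finset.sum_sub_distrib, ← Finset.mul_sum] at h4
  have e2 : 2 * starlikeSum l = ∑ i, (l i : ℝ) +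
      ∑ i, ∑ j, if i = j then samePathSum (l i) else twoPathSum (l i) (l j) := by
    rw [starlikeSum, ← mul_assoc]
    norm_num
    congr!
  linarith

/-- The neighbour of a vertex of a starlike tree in the direction of the centre. -/
def starlikeParent (l : Fin k → ℕ) (x : Σ i : Fin k, Fin (l i)) :
    Option (Σ i : Fin k, Fin (l i)) :=
  if x.2.val = 0 then none else some ⟨x.1, x.2.val - 1, by omega⟩

theorem starlikeTree_adj_some_iff (x : Σ i : Fin k, Fin (l i)) (y) :
    (starlikeTree l).Adj (some x) y ↔
      y = starlikeParent l x ∨ ∃ h : x.2.val + 1 < l x.1, y = some ⟨x.1, x.2.val + 1, h⟩ := by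
  obtain ⟨i, a, ha⟩ := x
  rcases y with _ | ⟨j, b, hb⟩
  · rw [SimpleGraph.adj_comm, starlikeTree_adj_none_some]
    simp [starlikeParent]
  · rw [starlikeTree_adj_some_some]
    simp only [starlikeParent]
    constructor
    · rintro ⟨rfl, h | h⟩
      · subst h
        exact Or.inr ⟨hb, rfl⟩
      · subst h
        exact Or.inl (by simp)
    · rintro (h | ⟨h1, h⟩)
      · split_ifs at h with h0
        simp only [Option.some.injEq, Sigma.mk.injEq] at h
        obtain ⟨rfl, h⟩ := h
        rw [heq_eq_eq, Fin.mk.injEq] at h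
        exact ⟨rfl, Or.inr (by omega)⟩
      · simp only [Option.some.injEq, Sigma.mk.injEq] at h
        obtain ⟨rfl, h⟩ := h
        rw [heq_eq_eq, Fin.mk.injEq] at h
        exact ⟨rfl, Or.inl (by omega)⟩

/-- Every edge joins a vertex to its `starlikeParent`, so there are at most as many edges as
vertices other than the centre. -/
theorem starlikeTree_isTree (l : Fin k → ℕ) : (starlikeTree l).IsTree := by
  have hc := starlikeTree_connected l
  rw [SimpleGraph.isTree_iff_connected_and_card]
  refine ⟨hc, le_antisymm ?_ hc.card_vert_le_card_edgeSet_add_one⟩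
  rw [Finite.card_option]
  have hsub : (starlikeTree l).edgeSet ⊆
      Set.range fun x : Σ i : Fin k, Fin (l i) => s(some x, starlikeParent l x) := by
    intro e
    induction e with
    | h u v =>
      rw [SimpleGraph.mem_edgeSet]
      intro huv
      rcases u with _ | x
      · rcases v with _ | y
        · simp at huv
        · have h0 := (starlikeTree_adj_none_some y).1 huv
          exact ⟨y, by rw [Sym2.eq_swap]; simp [starlikeParent, h0]⟩
      · rcases (starlikeTree_adj_some_iff x v).1 huv with rfl | ⟨h, rfl⟩
        · exact ⟨x, rfl⟩
        · exact ⟨⟨x.1, x.2.val + 1, h⟩, by rw [Sym2.eq_swap]; simp [starlikeParent]⟩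
  have h1 := Nat.card_mono (Set.toFinite _) hsub
  have h2 := Finite.card_range_le fun x : Σ i : Fin k, Fin (l i) => s(some x, starlikeParent l x)
  omega

theorem card_starlikeTree_vertices (l : Fin k → ℕ) :
    Fintype.card (Option (Σ i : Fin k, Fin (l i))) = ∑ i, l i + 1 := by
  simp

/-- The form `ncard` does not depend on a `Fintype` instance and can be rewritten freely. -/
theorem SimpleGraph.degree_eq_ncard_neighborSet {V : Type*} (G : SimpleGraph V) (v : V)
    [Fintype (G.neighborSet v)] : G.degree v = (G.neighborSet v).ncard := by
  rw [← G.card_neighborSet_eq_degree, Set.ncard_eq_toFinset_card', Set.toFinset_card]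

theorem starlikeTree_ncard_neighborSet_none (hl : ∀ i, 1 ≤ l i) :
    ((starlikeTree l).neighborSet none).ncard = k := by
  have : (starlikeTree l).neighborSet none = Set.range fun i : Fin k => some ⟨i, 0, hl i⟩ := by
    ext y
    rw [SimpleGraph.mem_neighborSet]
    rcases y with _ | ⟨i, a, ha⟩
    · simp
    · rw [starlikeTree_adj_none_some]
      constructor
      · intro h
        simp only at h
        subst h
        exact ⟨i, rfl⟩
      · rintro ⟨j, hj⟩
        simp only [Option.some.injEq, Sigma.mk.injEq] at hj
        obtain ⟨rfl, hj⟩ := hj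
        rw [heq_eq_eq, Fin.mk.injEq] at hj
        exact hj.symm
  rw [this, ← Nat.card_coe_set_eq, Nat.card_range_of_injective, Nat.card_fin]
  intro i j hij
  simp only [Option.some.injEq, Sigma.mk.injEq] at hij
  exact hij.1

theorem starlikeTree_ncard_neighborSet_some_eq_two_iff (x : Σ i : Fin k, Fin (l i)) :
    ((starlikeTree l).neighborSet (some x)).ncard = 2 ↔ x.2.val < l x.1 - 1 := by
  by_cases h : x.2.val + 1 < l x.1
  · have e : (starlikeTree l).neighborSet (some x) =
        {starlikeParent l x, some ⟨x.1, x.2.val + 1, h⟩} := by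
      ext y
      rw [SimpleGraph.mem_neighborSet, starlikeTree_adj_some_iff]
      simp [h]
    rw [e, Set.ncard_pair]
    · simp only [true_iff]
      omega
    · unfold starlikeParent
      split_ifs
      · simp
      · simp
  · have e : (starlikeTree l).neighborSet (some x) = {starlikeParent l x} := by
      ext y
      rw [SimpleGraph.mem_neighborSet, starlikeTree_adj_some_iff]
      simp [h]
    rw [e, Set.ncard_singleton]
    simp only [OfNat.one_ne_ofNat, false_iff]
    omega

/-- Every leg contributes all its vertices but the leaf; `k ≠ 2` keeps the centre out. -/
theorem numDegreeTwo_starlikeTree (hl : ∀ i, 1 ≤ l i) (hk : k ≠ 2) :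
    (starlikeTree l).numDegreeTwo + k = ∑ i, l i := by
  classical
  have h1 : (starlikeTree l).numDegreeTwo = ∑ i, (l i - 1) := by
    rw [SimpleGraph.numDegreeTwo, Finset.card_filter]
    simp only [SimpleGraph.degree_eq_ncard_neighborSet, Fintype.sum_option, Fintype.sum_sigma,
      starlikeTree_ncard_neighborSet_none hl, if_neg hk, zero_add,
      starlikeTree_ncard_neighborSet_some_eq_two_iff]
    refine Finset.sum_congr rfl fun i _ => ?_
    rw [← Finset.card_filter, Fin.card_filter_val_lt]
    omega
  have h2 : ∑ i, l i = ∑ i, ((l i - 1) + 1) :=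
    Finset.sum_congr rfl fun i _ => by have := hl i; omega
  rw [h1, h2, Finset.sum_add_distrib]
  simp

end starlike

/-! ### Isomorphisms and the equality case. -/

namespace SimpleGraph

theorem Iso.dist_eq {V W : Type*} {G : SimpleGraph V} {G' : SimpleGraph W} (f : G ≃g G')
    (hG : G.Connected) (u v : V) : G'.dist (f u) (f v) = G.dist u v := by
  have hG' : G'.Connected := f.connected_iff.1 hG
  apply le_antisymm
  · obtain ⟨w, hw⟩ := hG.exists_walk_length_eq_dist u v
    rw [← hw, ← Walk.length_map f.toHom w]
    exact dist_le _
  · obtain ⟨w, hw⟩ := hG'.exists_walk_length_eq_dist (f u) (f v)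
    have h1 := dist_le (w.map f.symm.toHom)
    rw [Walk.length_map, hw] at h1
    simpa using h1

theorem Iso.hararyIndex_eq {V W : Type*} [Fintype V] [Fintype W] {G : SimpleGraph V}
    {G' : SimpleGraph W} (f : G ≃g G') (hG : G.Connected) : G.hararyIndex = G'.hararyIndex := by
  unfold hararyIndex
  rw [← f.toEquiv.sum_comp]
  congr 1
  refine Finset.sum_congr rfl fun u _ => ?_
  rw [← f.toEquiv.sum_comp]
  refine Finset.sum_congr rfl fun v _ => ?_
  have h := f.dist_eq hG u v
  simp only [reciprocalDistMatrix, Matrix.of_apply]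
  by_cases huv : u = v
  · simp [huv]
  · rw [if_neg huv, if_neg (f.toEquiv.injective.ne huv)]
    exact congrArg (fun d : ℕ => 1 / (d : ℝ)) h.symm

theorem IsParentMap.ne_of_parent_eq {V : Type*} {T : SimpleGraph V} {r : V} {p : V → V}
    (h : IsParentMap T r p) {v u : V} (hv : v ≠ r) (hu : u ≠ r) (huv : p u = v) : p v ≠ u := by
  intro hvu
  have h1 := h.dist_parent v hv
  have h2 := h.dist_parent u hu
  rw [hvu] at h1
  rw [huv] at h2
  omega

/-- One of the two neighbours is the parent, so the other is the only child. The root has no parent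
and must therefore not have degree two. -/
theorem IsParentMap.hasUniqueChild {V : Type*} {T : SimpleGraph V} {r : V} {p : V → V}
    (h : IsParentMap T r p) (hr : (T.neighborSet r).ncard ≠ 2) :
    HasUniqueChild r p fun v => (T.neighborSet v).ncard ≠ 2 := by
  intro v hv
  rw [not_ne_iff] at hv
  have hvr : v ≠ r := by rintro rfl; exact hr hv
  have key : ∀ x y, T.neighborSet v = {x, y} → x ≠ y → p v = x →
      ∃! u, u ≠ r ∧ p u = v := by
    intro x y hxy hne hx
    have hy : T.Adj v y := by
      rw [← mem_neighborSet, hxy]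
      simp
    rcases (h.adj_iff _ _).1 hy with ⟨-, hy'⟩ | hy'
    · exact absurd (hx.symm.trans hy') hne
    · refine ⟨y, hy', fun u hu => ?_⟩
      have hu' : u ∈ T.neighborSet v := (h.adj_iff _ _).2 (Or.inr hu)
      rw [hxy] at hu'
      rcases hu' with rfl | hu'
      · exact absurd hx (h.ne_of_parent_eq hvr hu.1 hu.2)
      · exact hu'
  obtain ⟨x, y, hne, hxy⟩ := Set.ncard_eq_two.1 hv
  have hp : p v ∈ T.neighborSet v := h.adj_parent hvr
  rw [hxy] at hp
  rcases hp with hp | hp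
  · exact key x y hxy hne hp
  · exact key y x (hxy.trans (Set.pair_comm _ _)) hne.symm hp

end SimpleGraph

theorem starlikeTree_adj_iff {k : ℕ} {l : Fin k → ℕ} (x y : Option (Σ i : Fin k, Fin (l i))) :
    (starlikeTree l).Adj x y ↔ (∃ z, x = some z ∧ starlikeParent l z = y) ∨
      ∃ z, y = some z ∧ starlikeParent l z = x := by
  constructor
  · intro h
    rcases x with _ | x
    · rcases y with _ | y
      · simp at h
      · exact Or.inr ⟨y, rfl, by simp [starlikeParent, (starlikeTree_adj_none_some y).1 h]⟩
    · rcases (starlikeTree_adj_some_iff x y).1 h with rfl | ⟨h, rfl⟩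
      · exact Or.inl ⟨x, rfl, rfl⟩
      · exact Or.inr ⟨_, rfl, by simp [starlikeParent]⟩
  · rintro (⟨z, rfl, rfl⟩ | ⟨z, rfl, rfl⟩)
    · exact (starlikeTree_adj_some_iff _ _).2 (Or.inl rfl)
    · exact ((starlikeTree_adj_some_iff _ _).2 (Or.inl rfl)).symm

namespace SimpleGraph

variable {V : Type*} {T : SimpleGraph V} {r : V} {p : V → V} {B : V → Prop}

theorem IsParentMap.nonempty_iso_starlikeTree [Fintype V] [Fintype (SegIndex r B)]
    (h : IsParentMap T r p) (hr : B r) (hB : HasUniqueChild r p B)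
    (htop : ∀ v, v ≠ r → B v → p^[segLen p B v] v = r) {k : ℕ} {l : Fin k → ℕ}
    (e : Fin k ≃ SegIndex r B) (he : ∀ i, l i = segLen p B (e i).1) :
    Nonempty (T ≃g starlikeTree l) := by
  classical
  -- Legs are indexed from the centre but segments from their lower end, hence the reversal.
  let φ : Option (Σ i : Fin k, Fin (l i)) → V := fun x =>
    x.elim r fun y => p^[l y.1 - 1 - y.2.val] (e y.1).1
  have hlt : ∀ y : Σ i : Fin k, Fin (l i),
      l y.1 - 1 - y.2.val < segLen p B (e y.1).1 := fun y => by
    have := y.2.isLt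
    have := he y.1
    omega
  have hφr : ∀ y, φ (some y) ≠ r := fun y => h.iterate_ne_root hr (e y.1).2.1 (hlt y)
  have hinj : Function.Injective φ := by
    rintro (_ | x) (_ | y) hxy
    · rfl
    · exact absurd hxy.symm (hφr y)
    · exact absurd hxy (hφr x)
    · obtain ⟨h1, h2⟩ := h.segment_unique hr hB (e x.1).2.2 (e y.1).2.2 (hlt x) (hlt y) hxy
      obtain ⟨i, a, ha⟩ := x
      obtain ⟨j, b, hb⟩ := y
      obtain rfl : i = j := e.injective (Subtype.ext h1)
      simp only at h2
      obtain rfl : a = b := by omega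
      rfl
  have hcard : Fintype.card (Option (Σ i : Fin k, Fin (l i))) = Fintype.card V := by
    have h1 := h.sum_segLen hr hB
    have h2 : 1 ≤ Fintype.card V := Fintype.card_pos_iff.2 ⟨r⟩
    rw [card_starlikeTree_vertices, Finset.sum_congr rfl fun i _ => he i,
      e.sum_comp (fun v => segLen p B v.1), h1, Nat.sub_add_cancel h2]
  have hbij : Function.Bijective φ := (Fintype.bijective_iff_injective_and_card φ).2 ⟨hinj, hcard⟩
  have hparent : ∀ z, p (φ (some z)) = φ (starlikeParent l z) := by
    rintro ⟨i, a, ha⟩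
    change p (p^[l i - 1 - a] (e i).1) = _
    rw [← Function.iterate_succ_apply' p]
    unfold starlikeParent
    by_cases h0 : a = 0
    · subst h0
      rw [if_pos rfl, show (l i - 1 - 0).succ = l i by omega, he]
      exact htop _ (e i).2.1 (e i).2.2
    · rw [if_neg h0]
      change _ = p^[l i - 1 - (a - 1)] (e i).1
      rw [show (l i - 1 - a).succ = l i - 1 - (a - 1) by omega]
  refine ⟨RelIso.symm ⟨Equiv.ofBijective φ hbij, fun {x y} => ?_⟩⟩
  rw [Equiv.ofBijective_apply, Equiv.ofBijective_apply, h.adj_iff, starlikeTree_adj_iff]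
  have key : ∀ x y, (φ x ≠ r ∧ p (φ x) = φ y) ↔ ∃ z, x = some z ∧ starlikeParent l z = y := by
    rintro (_ | x) y
    · simp [φ]
    · rw [hparent, hinj.eq_iff]
      simp [hφr]
  rw [key, key]

/-- A top other than the root gives a strict loss against a segment in another branch. If there is
only one segment, such a top would index a second one. -/
theorem IsParentMap.top_eq_root_of_hararyIndex_eq [Fintype V] [Fintype (SegIndex r B)]
    (h : IsParentMap T r p) (hr : B r) (hB : HasUniqueChild r p B)
    (hroot : 2 < (T.neighborSet r).ncard ∨ Fintype.card (SegIndex r B) ≤ 1)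
    (heq : T.hararyIndex = starlikeSum (fun v : SegIndex r B => segLen p B v.1))
    (v : V) (hvr : v ≠ r) (hv : B v) : p^[segLen p B v] v = r := by
  by_contra ht
  rcases hroot with hroot | hroot
  · obtain ⟨c₁, c₂, hc₁, hc₂, hne⟩ := (Set.one_lt_ncard_iff (Set.toFinite _)).1 (by omega :
      1 < (T.neighborSet r).ncard)
    have hchild : ∀ c ∈ T.neighborSet r, c ≠ r ∧ p c = r := by
      intro c hc
      rcases (h.adj_iff _ _).1 hc with ⟨hh, -⟩ | hh
      · exact absurd rfl hh
      · exact hh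
    obtain ⟨v', hvr', hv', h1, h2, h3⟩ := h.exists_dist_top_ne_zero hr hB (hchild _ hc₁).1
      (hchild _ hc₂).1 hne (hchild _ hc₁).2 (hchild _ hc₂).2 hvr hv ht
    have hvv : v ≠ v' := by
      rintro rfl
      exact h1 (IsAncestor.refl p _)
    exact (h.segmentSum_lt hr hB hv hv' h1 h2 h3).ne
      ((h.hararyIndex_le_starlikeSum hr hB).2 heq ⟨v, hvr, hv⟩ ⟨v', hvr', hv'⟩
        (by simpa using hvv))
  · have h1 := Fintype.card_le_one_iff.1 hroot ⟨v, hvr, hv⟩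
      ⟨p^[segLen p B v] v, ht, (h.segLen_spec hr v).2⟩
    have h2 := congrArg (T.dist r) (congrArg Subtype.val h1)
    simp only [h.dist_root_iterate] at h2
    have h3 := (h.segLen_spec hr v).1
    have h4 := h.connected.pos_dist_of_ne hvr.symm
    omega

/-! ### Degree counting, the choice of the root and the conclusion. -/

open Classical in
theorem IsTree.sum_ncard_neighborSet [Fintype V] (hT : T.IsTree) :
    (∑ v ∈ Finset.univ.filter fun v => (T.neighborSet v).ncard ≠ 2, (T.neighborSet v).ncard) +
      2 * T.numDegreeTwo = 2 * (Fintype.card V - 1) ∧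
    (Finset.univ.filter fun v => (T.neighborSet v).ncard ≠ 2).card + T.numDegreeTwo =
      Fintype.card V := by
  have h1 := T.sum_degrees_eq_twice_card_edges
  have h2 := hT.card_edgeFinset
  have h3 : T.numDegreeTwo = (Finset.univ.filter fun v => (T.neighborSet v).ncard = 2).card := by
    rw [numDegreeTwo]
    simp only [degree_eq_ncard_neighborSet]
  have h4 : ∑ v ∈ Finset.univ.filter (fun v => (T.neighborSet v).ncard = 2),
      (T.neighborSet v).ncard = 2 * T.numDegreeTwo := by
    rw [h3, Finset.sum_congr rfl fun v hv => (Finset.mem_filter.1 hv).2]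
    simp [mul_comm]
  have h5 := Finset.sum_filter_add_sum_filter_not Finset.univ
    (fun v => (T.neighborSet v).ncard = 2) fun v => (T.neighborSet v).ncard
  have h6 := Finset.card_filter_add_card_filter_not (s := (Finset.univ : Finset V))
    (fun v => (T.neighborSet v).ncard = 2)
  simp only [degree_eq_ncard_neighborSet] at h1
  rw [Finset.card_univ] at h6
  simp only [ne_eq]
  constructor <;> omega

theorem IsTree.one_le_ncard_neighborSet [Fintype V] (hT : T.IsTree) (hV : 2 ≤ Fintype.card V)
    (v : V) : 1 ≤ (T.neighborSet v).ncard := by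
  classical
  have : Nontrivial V := Fintype.one_lt_card_iff_nontrivial.1 hV
  rw [← degree_eq_ncard_neighborSet]
  exact hT.connected.preconnected.degree_pos_of_nontrivial v

/-- The only vertex of degree other than two would have degree `0`. -/
theorem IsTree.numDegreeTwo_add_one_ne [Fintype V] (hT : T.IsTree) (hV : 2 ≤ Fintype.card V) :
    T.numDegreeTwo + 1 ≠ Fintype.card V := by
  classical
  intro hq
  obtain ⟨h1, h2⟩ := hT.sum_ncard_neighborSet
  obtain ⟨a, ha⟩ := Finset.card_eq_one.1 (by omega :
    (Finset.univ.filter fun v => (T.neighborSet v).ncard ≠ 2).card = 1)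
  rw [ha, Finset.sum_singleton] at h1
  have := hT.one_le_ncard_neighborSet hV a
  omega

/-- Three positive degrees with sum `4` include a `2`. -/
theorem IsTree.numDegreeTwo_add_three_ne [Fintype V] (hT : T.IsTree) :
    T.numDegreeTwo + 3 ≠ Fintype.card V := by
  classical
  intro hq
  obtain ⟨h1, h2⟩ := hT.sum_ncard_neighborSet
  obtain ⟨a, b, c, hab, hac, hbc, habc⟩ := Finset.card_eq_three.1 (by omega :
    (Finset.univ.filter fun v => (T.neighborSet v).ncard ≠ 2).card = 3)
  have hne : ∀ x ∈ ({a, b, c} : Finset V), (T.neighborSet x).ncard ≠ 2 := by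
    intro x hx
    rw [← habc] at hx
    exact (Finset.mem_filter.1 hx).2
  rw [habc, Finset.sum_insert (by simp [hab, hac]), Finset.sum_pair hbc] at h1
  have hpos := hT.one_le_ncard_neighborSet (by omega)
  have := hpos a
  have := hpos b
  have := hpos c
  have := hne a (by simp)
  have := hne b (by simp)
  have := hne c (by simp)
  omega

/-- Without a branching vertex, the `k + 1` degrees other than two are at most `1`, yet they sum to
`2 * k`; so `k ≤ 1`. -/
theorem IsTree.exists_root [Fintype V] (hT : T.IsTree) {k : ℕ}
    (hcard : T.numDegreeTwo + k + 1 = Fintype.card V) :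
    ∃ r, (T.neighborSet r).ncard ≠ 2 ∧ (2 < (T.neighborSet r).ncard ∨ k ≤ 1) := by
  classical
  obtain ⟨h1, h2⟩ := hT.sum_ncard_neighborSet
  by_cases hk1 : k ≤ 1
  · obtain ⟨r, hr⟩ := Finset.card_pos.1 (by omega :
      0 < (Finset.univ.filter fun v => (T.neighborSet v).ncard ≠ 2).card)
    exact ⟨r, (Finset.mem_filter.1 hr).2, Or.inr hk1⟩
  · by_contra! hcon
    have hone : ∀ v ∈ Finset.univ.filter fun v => (T.neighborSet v).ncard ≠ 2,
        (T.neighborSet v).ncard ≤ 1 := by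
      intro v hv
      have h3 := (Finset.mem_filter.1 hv).2
      have := (hcon v h3).1
      omega
    have h4 := Finset.sum_le_card_nsmul _ _ 1 hone
    rw [smul_eq_mul, mul_one] at h4
    omega

theorem IsTree.hararyIndex_le_balancedStarlikeTree [Fintype V] (hT : T.IsTree) {n k : ℕ}
    (hk : k ≠ 2) (hn : Fintype.card V = n) (hcard : T.numDegreeTwo + k + 1 = n) :
    T.hararyIndex ≤ (balancedStarlikeTree n k).hararyIndex ∧
      (T.hararyIndex = (balancedStarlikeTree n k).hararyIndex ↔
        Nonempty (T ≃g balancedStarlikeTree n k)) := by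
  classical
  subst hn
  obtain ⟨r, hr, hroot⟩ := hT.exists_root hcard
  obtain ⟨p, h⟩ := hT.exists_isParentMap r
  set B : V → Prop := fun v => (T.neighborSet v).ncard ≠ 2 with hBdef
  have hrB : B r := hr
  have hB : HasUniqueChild r p B := h.hasUniqueChild hr
  have hseg : Fintype.card (SegIndex r B) = k := by
    have h1 : (Finset.univ.filter fun v => v ≠ r ∧ B v) = (Finset.univ.filter B).erase r := by
      ext v
      simp
    have h2 := hT.sum_ncard_neighborSet.2
    rw [Fintype.card_subtype, h1, Finset.card_erase_of_mem (by simpa using hrB)]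
    change (Finset.univ.filter B).card + _ = _ at h2
    omega
  obtain ⟨h1, -⟩ := h.hararyIndex_le_starlikeSum hrB hB
  obtain ⟨h2, h3⟩ := starlikeSum_le_balancedLength (n := Fintype.card V) hk hseg
    (s := fun v : SegIndex r B => segLen p B v.1) (fun v => (h.segLen_spec hrB v.1).1)
    (h.sum_segLen hrB hB)
  have h4 := starlikeSum_le_hararyIndex (balancedLength (Fintype.card V) k)
  refine ⟨h1.trans (h2.trans h4), fun heq => ?_, fun ⟨f⟩ => f.hararyIndex_eq hT.connected⟩
  -- Equality collapses the chain `h1`, `h2`, `h4`: the middle link gives the segment lengths, the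
  -- first one the starlike shape.
  obtain ⟨e, he⟩ := h3 (le_antisymm h2 (h4.trans (heq ▸ h1)))
  exact h.nonempty_iso_starlikeTree hrB hB
    (h.top_eq_root_of_hararyIndex_eq hrB hB (hseg ▸ hroot)
      (le_antisymm h1 (h2.trans (h4.trans heq.ge)))) e.symm fun i => by
        have := congrFun he (e.symm i)
        simpa using this.symm

end SimpleGraph

theorem one_le_balancedLength {n k : ℕ} (hkn : k ≤ n - 1) (i : Fin k) : 1 ≤ balancedLength n k i := by
  have hk : 0 < k := i.pos
  have := Nat.div_pos hkn hk
  unfold balancedLength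
  omega

theorem sum_balancedLength_of_le {n k : ℕ} (h : k = 0 → n - 1 = 0) :
    ∑ i : Fin k, balancedLength n k i = n - 1 := by
  rcases Nat.eq_zero_or_pos k with rfl | hk
  · simp [h rfl]
  · exact sum_balancedLength n k hk

theorem theorem3p2 (n q : ℕ) (hq : q + 1 ≤ n) :
    -- the values of `q` for which there is no such tree
    ((q + 3 = n ∨ (q + 1 = n ∧ 2 ≤ n)) →
      ∀ (V : Type*) [Fintype V] (T : SimpleGraph V),
        T.IsTree → Fintype.card V = n → T.numDegreeTwo ≠ q) ∧
    -- all the other values of `q`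
    (¬ (q + 3 = n ∨ (q + 1 = n ∧ 2 ≤ n)) →
      -- the balanced starlike tree belongs to the class
      (balancedStarlikeTree n (n - 1 - q)).IsTree ∧
      Fintype.card (Option (Σ i : Fin (n - 1 - q), Fin (balancedLength n (n - 1 - q) i))) = n ∧
      (balancedStarlikeTree n (n - 1 - q)).numDegreeTwo = q ∧
      -- it is a maximizer, and every maximizer is isomorphic to it
      ∀ (V : Type*) [Fintype V] (T : SimpleGraph V),
        T.IsTree → Fintype.card V = n → T.numDegreeTwo = q →
          T.hararyIndex ≤ (balancedStarlikeTree n (n - 1 - q)).hararyIndex ∧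
          (T.hararyIndex = (balancedStarlikeTree n (n - 1 - q)).hararyIndex ↔
            Nonempty (T ≃g balancedStarlikeTree n (n - 1 - q)))) := by
  refine ⟨?_, fun hcase => ?_⟩
  · rintro (hn | ⟨hn, h2⟩) V _ T hT hV rfl
    · exact hT.numDegreeTwo_add_three_ne (hn.trans hV.symm)
    · exact hT.numDegreeTwo_add_one_ne (hV ▸ h2) (hn.trans hV.symm)
  -- There are no legs only if `n = 1`, as `q = n - 1` with `n ≥ 2` is excluded; similarly `q ≠ n -
  -- 3` gives `k ≠ 2` below.
  · have hsum : ∑ i, balancedLength n (n - 1 - q) i = n - 1 := sum_balancedLength_of_le (by omega)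
    have hdeg := numDegreeTwo_starlikeTree (one_le_balancedLength (by omega : n - 1 - q ≤ n - 1))
      (by omega)
    refine ⟨starlikeTree_isTree _, ?_, ?_, fun V _ T hT hV hTq => ?_⟩
    · rw [card_starlikeTree_vertices, hsum]
      omega
    · rw [hsum] at hdeg
      change (starlikeTree _).numDegreeTwo = q
      omega
    · exact hT.hararyIndex_le_balancedStarlikeTree (by omega) hV (by omega)
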